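/- Let $m\ge 1$ be an integer and let $W_1,W_2,\dots$ be i.i.d. copies of a random variable $W$ with $\mathbb P(W>0)=1$ and $\sup\{x>0:\mathbb P(W\le x)<1\}=1$ (so $W$ is almost surely bounded with essential supremum $1$). Set $S_n=\sum_{i=1}^n W_i$. The weighted recursive graph $(G_n)_{n\ge1}$ with out-degree $m$ is the following sequence of random directed multigraphs, where $G_n$ has vertex set $\{1,\dots,n\}$. The graph $G_1$ is the single vertex $1$, with weight $W_1$ and no edges. For $n\ge1$, $G_{n+1}$ is obtained from $G_n$ by adding the vertex $n+1$ with weight $W_{n+1}$ and $m$ edges directed from $n+1$ to vertices of $G_n$; conditionally on the weights $(W_i)_{i\ge1}$ and on $G_n$, the endpoints of these $m$ edges are independent, each being equal to $i\in\{1,\dots,n\}$ with probability $W_i/S_n$. Let $\mathcal Z_n(i)$ be the in-degree (counted with multiplicity) of vertex $i$ in $G_n$ and let $$I_n=\min\{i\in\{1,\dots,n\}:\mathcal Z_n(i)\ge \mathcal Z_n(j)\text{ for all }j\in\{1,\dots,n\}\}$$ be the smallest label among the vertices of maximum in-degree. Put $\theta_m=1+\mathbb E[W]/m$. Then $$\frac{\log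 I_n}{\log n}\longrightarrow \mu_m:=1-\frac{\theta_m-1}{\theta_m\log\theta_m}\qquad\text{almost surely as } n\to\infty .$$ -/

import Mathlib

open MeasureTheory ProbabilityTheory Filter Topology

namespace WRG

variable {Ω : Type*}

/-! Vertices are labelled `1, 2, 3, …`. The weight of vertex `i ≥ 1` is `W i`, and `T j k` is the
vertex to which the `k`-th half-edge of vertex `j ≥ 2` is connected. The graph `G_n` is the directed
multigraph on `{1, …, n}` with one edge `j → T j k` for each `2 ≤ j ≤ n` and `k : Fin m`. The values
`W 0`, `T 0` and `T 1` have no meaning and are never used. -/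

/-- `S_n = W_1 + ⋯ + W_n`. -/
noncomputable def totalWeight (W : ℕ → Ω → ℝ) (n : ℕ) (ω : Ω) : ℝ :=
  ∑ i ∈ Finset.Icc 1 n, W i ω

/-- The σ-algebra generated by all the vertex-weights and by the edges of `G_n`. -/
abbrev history {m : ℕ} (W : ℕ → Ω → ℝ) (T : ℕ → Fin m → Ω → ℕ) (n : ℕ) : MeasurableSpace Ω :=
  (⨆ i ∈ Set.Ici 1, MeasurableSpace.comap (W i) inferInstance) ⊔
    ⨆ j ∈ Set.Icc 2 n, ⨆ k : Fin m, MeasurableSpace.comap (T j k) inferInstance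

/-- `(W, T)` is a realisation, on the probability space `(Ω, μ)`, of the weighted recursive graph
with out-degree `m` and vertex-weight distribution `ν`: the weights are i.i.d. with law `ν` and,
given the weights and `G_n`, the `m` half-edges of vertex `n + 1` are connected independently, each
to the vertex `i ∈ {1, …, n}` with probability `W_i / S_n`.

Later weights are part of what is conditioned on: they have no influence on how the
half-edges of vertex `n + 1` are connected. -/
structure IsWRG [MeasurableSpace Ω] (μ : Measure Ω) (ν : Measure ℝ) (m : ℕ)
    (W : ℕ → Ω → ℝ) (T : ℕ → Fin m → Ω → ℕ) : Prop where
  measurable_weight : ∀ i, 1 ≤ i → Measurable (W i)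
  weight_law : ∀ i, 1 ≤ i → μ.map (W i) = ν
  weight_indep : iIndepFun (fun i : ℕ => W (i + 1)) μ
  measurable_target : ∀ j, 2 ≤ j → ∀ k, Measurable (T j k)
  target_condProb : ∀ n, 1 ≤ n → ∀ a : Fin m → ℕ, (∀ k, a k ∈ Finset.Icc 1 n) →
    μ⟦{ω | ∀ k, T (n + 1) k ω = a k} | history W T n⟧ =ᵐ[μ]
      fun ω => ∏ k, W (a k) ω / totalWeight W n ω

/-- The in-degree of vertex `i` in `G_n`, counted with multiplicity. -/
def inDegree {m : ℕ} (T : ℕ → Fin m → Ω → ℕ) (n i : ℕ) (ω : Ω) : ℕ :=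
  ((Finset.Icc 2 n ×ˢ (Finset.univ : Finset (Fin m))).filter fun e => T e.1 e.2 ω = i).card

/-- `I_n`: the smallest label among the vertices of maximum in-degree in `G_n`. -/
noncomputable def maxDegreeLabel {m : ℕ} (T : ℕ → Fin m → Ω → ℕ) (n : ℕ) (ω : Ω) : ℕ :=
  sInf {i | i ∈ Finset.Icc 1 n ∧ ∀ j ∈ Finset.Icc 1 n, inDegree T n j ω ≤ inDegree T n i ω}

/-- `θ_m = 1 + E[W] / m`. -/
noncomputable def theta (ν : Measure ℝ) (m : ℕ) : ℝ := 1 + (∫ x, x ∂ν) / m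

/-- `μ_m = 1 - (θ_m - 1) / (θ_m log θ_m)`. -/
noncomputable def muExponent (ν : Measure ℝ) (m : ℕ) : ℝ :=
  1 - (theta ν m - 1) / (theta ν m * Real.log (theta ν m))

end WRG

/-! Write c = E[W], θ = θ_m, u = (t-1)/(θ-1), x = log I_n / log n. Given the weights, vertex i
receives from vertex j+1 a binomial number of edges with parameters m and W_i/S_j, independently
over j, and S_j ~ cj by the strong law. Two almost sure estimates are played against each other.

Upper bound. Since W_i ≤ 1, E[t^{Z_n(i)}] is at most about (n/i)^u. A summation over vertices and
over dyadic times gives, for each t > 1 and uniformly in i ≤ n, Z_n(i) log t ≤ (1-u) log i + u log n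
+ o(log n) (`IsWRG.ae_inDegree_le`).

Lower bound. Some vertex has in-degree at least (1/log θ - o(1)) log n
(`IsWRG.ae_exists_le_inDegree`). Of the first n^γ vertices a positive fraction has weight at least
1-ε. Tilting by θ (`exists_tilt`) bounds from below the probability n^{-g} that one of them gains
about y log n edges, with y = θ(1-γ)/(θ-1). If g < γ, some vertex should succeed. In-degrees of
different vertices are dependent, but negatively: the probability that all fail is at most the
product of the individual ones (`IsWRG.lintegral_evolve_le`), and Borel-Cantelli applies. The
optimal γ is μ_m itself.

Conclusion. At i = I_n the estimates give log t / log θ - u ≤ (1-u) x up to o(1)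
(`IsWRG.ae_eventually_label`). For t < θ the factor 1-u is positive and x is bounded below; for t >
θ it is negative and x is bounded above. Both bounds equal (u - log t / log θ)/(u - 1), which tends
to μ_m as t → θ, by the derivative of log at θ (`tendsto_exponent`). -/

namespace WRG

/-! ### Sums of independent Bernoulli variables, as positive linear operators -/

/-- The operator `f ↦ E[f (· + X)]`, where `X` is a Bernoulli variable with parameter `p`. -/
def bernStep (p : ℝ) : Module.End ℝ (ℕ → ℝ) where
  toFun f k := (1 - p) * f k + p * f (k + 1)
  map_add' f g := by ext k; simp only [Pi.add_apply]; ring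
  map_smul' c f := by ext k; simp only [Pi.smul_apply, smul_eq_mul, RingHom.id_apply]; ring

lemma bernStep_apply (p : ℝ) (f : ℕ → ℝ) (k : ℕ) :
    bernStep p f k = (1 - p) * f k + p * f (k + 1) := rfl

/-- The operator `f ↦ E[f (· + X)]`, where `X` is a sum of independent Bernoulli variables, `m` of
them with parameter `p j` for each `N ≤ j < N + d`. -/
def evolve (m : ℕ) (p : ℕ → ℝ) (N : ℕ) : ℕ → Module.End ℝ (ℕ → ℝ)
  | 0 => 1
  | d + 1 => evolve m p N d * bernStep (p (N + d)) ^ m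

lemma evolve_zero (m : ℕ) (p : ℕ → ℝ) (N : ℕ) (f : ℕ → ℝ) : evolve m p N 0 f = f := rfl

lemma evolve_succ (m : ℕ) (p : ℕ → ℝ) (N d : ℕ) (f : ℕ → ℝ) :
    evolve m p N (d + 1) f = evolve m p N d ((bernStep (p (N + d)) ^ m) f) := rfl

lemma bernStep_pow_induction {P : (ℕ → ℝ) → Prop} {p : ℝ} (h : ∀ f, P f → P (bernStep p f))
    (m : ℕ) {f : ℕ → ℝ} (hf : P f) : P ((bernStep p ^ m) f) := by
  induction m with
  | zero => simpa using hf
  | succ m ih => rw [pow_succ']; exact h _ ih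

lemma evolve_induction {P : (ℕ → ℝ) → Prop} {p : ℕ → ℝ} {N : ℕ}
    (h : ∀ j, N ≤ j → ∀ f, P f → P (bernStep (p j) f)) (m d : ℕ) {f : ℕ → ℝ} (hf : P f) :
    P (evolve m p N d f) := by
  induction d generalizing f with
  | zero => exact hf
  | succ d ih => exact ih (bernStep_pow_induction (h _ (Nat.le_add_right _ _)) m hf)

lemma bernStep_nonneg {p : ℝ} (h0 : 0 ≤ p) (h1 : p ≤ 1) {f : ℕ → ℝ} (hf : 0 ≤ f) :
    0 ≤ bernStep p f := fun k => by
  rw [bernStep_apply]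
  have := hf k; have := hf (k + 1); have : 0 ≤ 1 - p := by linarith
  simp only [Pi.zero_apply] at *
  positivity

lemma bernStep_antitone {p : ℝ} (h0 : 0 ≤ p) (h1 : p ≤ 1) {f : ℕ → ℝ} (hf : Antitone f) :
    Antitone (bernStep p f) := fun k l hkl => by
  rw [bernStep_apply, bernStep_apply]
  have : 0 ≤ 1 - p := by linarith
  have := hf hkl; have := hf (Nat.add_le_add_right hkl 1)
  gcongr

lemma bernStep_monotone {p : ℝ} (h0 : 0 ≤ p) (h1 : p ≤ 1) {f : ℕ → ℝ} (hf : Monotone f) :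
    Monotone (bernStep p f) := fun k l hkl => by
  rw [bernStep_apply, bernStep_apply]
  have : 0 ≤ 1 - p := by linarith
  have := hf hkl; have := hf (Nat.add_le_add_right hkl 1)
  gcongr

lemma evolve_nonneg {m : ℕ} {p : ℕ → ℝ} {N : ℕ} (h : ∀ j, N ≤ j → 0 ≤ p j ∧ p j ≤ 1) (d : ℕ)
    {f : ℕ → ℝ} (hf : 0 ≤ f) : 0 ≤ evolve m p N d f :=
  evolve_induction (fun j hj _ hg => bernStep_nonneg (h j hj).1 (h j hj).2 hg) m d hf

lemma evolve_antitone {m : ℕ} {p : ℕ → ℝ} {N : ℕ} (h : ∀ j, N ≤ j → 0 ≤ p j ∧ p j ≤ 1) (d : ℕ)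
    {f : ℕ → ℝ} (hf : Antitone f) : Antitone (evolve m p N d f) :=
  evolve_induction (fun j hj _ hg => bernStep_antitone (h j hj).1 (h j hj).2 hg) m d hf

lemma evolve_mono {m : ℕ} {p : ℕ → ℝ} {N : ℕ} (h : ∀ j, N ≤ j → 0 ≤ p j ∧ p j ≤ 1) (d : ℕ)
    {f g : ℕ → ℝ} (hfg : f ≤ g) : evolve m p N d f ≤ evolve m p N d g := by
  have := evolve_nonneg (m := m) h d (sub_nonneg.2 hfg)
  rwa [map_sub, sub_nonneg] at this

/-- Geometric functions are eigenvectors of every Bernoulli step, with eigenvalue 1 + (t-1)p; hence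
moment generating functions are plain products. -/
lemma bernStep_pow_geom (p t : ℝ) (m : ℕ) :
    (bernStep p ^ m) (fun k => t ^ k) = (1 + (t - 1) * p) ^ m • fun k => t ^ k := by
  induction m with
  | zero => simp
  | succ m ih =>
    rw [pow_succ', Module.End.mul_apply, ih, map_smul]
    ext k
    simp only [Pi.smul_apply, smul_eq_mul, bernStep_apply]
    ring

/-- The moment generating function of a sum of independent Bernoulli variables. -/
lemma evolve_geom (m : ℕ) (p : ℕ → ℝ) (N d : ℕ) (t : ℝ) :
    evolve m p N d (fun k => t ^ k) =
      (∏ j ∈ Finset.range d, (1 + (t - 1) * p (N + j)) ^ m) • fun k => t ^ k := by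
  induction d with
  | zero => simp [evolve_zero]
  | succ d ih =>
    rw [evolve_succ, bernStep_pow_geom, map_smul, ih, Finset.prod_range_succ, smul_smul, mul_comm]

lemma evolve_one (m : ℕ) (p : ℕ → ℝ) (N d : ℕ) : evolve m p N d 1 = 1 := by
  have := evolve_geom m p N d 1
  simp only [one_pow, sub_self, zero_mul, add_zero, Finset.prod_const_one, one_smul] at this
  exact this

lemma evolve_geom_le {m : ℕ} {p : ℕ → ℝ} {N : ℕ} (h : ∀ j, N ≤ j → 0 ≤ p j ∧ p j ≤ 1) (d : ℕ)
    {t : ℝ} (ht : 0 ≤ t) :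
    evolve m p N d (fun k => t ^ k) 0 ≤
      Real.exp ((t - 1) * (m * ∑ j ∈ Finset.range d, p (N + j))) := by
  rw [evolve_geom]
  simp only [Pi.smul_apply, pow_zero, smul_eq_mul, mul_one]
  have : (t - 1) * (m * ∑ j ∈ Finset.range d, p (N + j)) =
      ∑ j ∈ Finset.range d, m * ((t - 1) * p (N + j)) := by
    rw [Finset.mul_sum, Finset.mul_sum]; exact Finset.sum_congr rfl fun j _ => by ring
  rw [this, Real.exp_sum]
  refine Finset.prod_le_prod (fun j _ => ?_) fun j _ => ?_
  · obtain ⟨h0, h1⟩ := h (N + j) (Nat.le_add_right _ _)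
    exact pow_nonneg (by nlinarith) _
  · obtain ⟨h0, h1⟩ := h (N + j) (Nat.le_add_right _ _)
    rw [Real.exp_nat_mul]
    refine pow_le_pow_left₀ (by nlinarith) ?_ _
    linarith [Real.add_one_le_exp ((t - 1) * p (N + j))]

/-- log(1+x) ≥ x/(1+x) ≥ x - x², because (x - x²)(1+x) = x - x³. -/
lemma exp_sub_sq_le_one_add {x : ℝ} (hx : 0 ≤ x) : Real.exp (x - x ^ 2) ≤ 1 + x := by
  rw [← Real.le_log_iff_exp_le (by linarith)]
  refine le_trans ?_ (Real.one_sub_inv_le_log_of_pos (by linarith))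
  have : 1 - (1 + x)⁻¹ = x / (1 + x) := by field_simp; ring
  rw [this, le_div_iff₀ (by linarith)]
  nlinarith [pow_nonneg hx 3]

/-- Matches `evolve_geom_le` up to the sum of the squares. With p of order 1/j that sum stays
bounded, so only a constant factor is lost. -/
lemma le_evolve_geom {m : ℕ} {p : ℕ → ℝ} {N : ℕ} (h : ∀ j, N ≤ j → 0 ≤ p j ∧ p j ≤ 1) (d : ℕ)
    {t : ℝ} (ht : 1 ≤ t) :
    Real.exp ((t - 1) * (m * ∑ j ∈ Finset.range d, p (N + j)) -
        (t - 1) ^ 2 * (m * ∑ j ∈ Finset.range d, p (N + j) ^ 2)) ≤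
      evolve m p N d (fun k => t ^ k) 0 := by
  rw [evolve_geom]
  simp only [Pi.smul_apply, pow_zero, smul_eq_mul, mul_one]
  have : (t - 1) * (m * ∑ j ∈ Finset.range d, p (N + j)) -
        (t - 1) ^ 2 * (m * ∑ j ∈ Finset.range d, p (N + j) ^ 2) =
      ∑ j ∈ Finset.range d, m * ((t - 1) * p (N + j) - ((t - 1) * p (N + j)) ^ 2) := by
    simp only [Finset.mul_sum, ← Finset.sum_sub_distrib]
    exact Finset.sum_congr rfl fun j _ => by ring
  rw [this, Real.exp_sum]
  refine Finset.prod_le_prod (fun j _ => (Real.exp_pos _).le) fun j _ => ?_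
  rw [Real.exp_nat_mul]
  refine pow_le_pow_left₀ (Real.exp_pos _).le (exp_sub_sq_le_one_add ?_) _
  exact mul_nonneg (by linarith) (h (N + j) (Nat.le_add_right _ _)).1

/-- A lower bound for the indicator of `[a, ∞)` by exponential functions. -/
lemma exp_comb_le_indicator {t s a b : ℝ} (ht : 1 ≤ t) (hs : 1 < s) (k : ℕ) :
    t ^ (-b) * (t ^ k - s ^ (-b) * (t * s) ^ k - s ^ a * (t / s) ^ k) ≤
      if (k : ℝ) < a then 0 else 1 := by
  have ht0 : 0 < t := by linarith
  have hs0 : 0 < s := by linarith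
  have htk : 0 < t ^ k := by positivity
  have h1 : s ^ (-b) * (t * s) ^ k = t ^ k * s ^ ((k : ℝ) - b) := by
    rw [mul_pow, sub_eq_neg_add, Real.rpow_add hs0, Real.rpow_natCast]; ring
  have h2 : s ^ a * (t / s) ^ k = t ^ k * s ^ (a - k) := by
    rw [div_pow, Real.rpow_sub hs0, Real.rpow_natCast]; ring
  rw [h1, h2]
  have p1 : 0 < s ^ ((k : ℝ) - b) := by positivity
  have p2 : 0 < s ^ (a - (k : ℝ)) := by positivity
  have p3 : 0 < t ^ (-b) := by positivity
  -- Below a the term s^(a-k) ≥ 1 outweighs the main one, above b the term s^(k-b) does; on [a, b]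
  -- both are dropped and t^(k-b) ≤ 1 remains.
  split_ifs with hk
  · refine mul_nonpos_of_nonneg_of_nonpos p3.le ?_
    have : 1 ≤ s ^ (a - (k : ℝ)) := Real.one_le_rpow hs.le (by linarith)
    nlinarith
  · by_cases hkb : (k : ℝ) ≤ b
    · calc t ^ (-b) * (t ^ k - t ^ k * s ^ ((k : ℝ) - b) - t ^ k * s ^ (a - k))
          ≤ t ^ (-b) * t ^ k := by
            gcongr
            nlinarith [mul_pos htk p1, mul_pos htk p2]
        _ = t ^ ((k : ℝ) - b) := by rw [sub_eq_neg_add, Real.rpow_add ht0, Real.rpow_natCast]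
        _ ≤ 1 := Real.rpow_le_one_of_one_le_of_nonpos ht (by linarith)
    · refine le_trans (mul_nonpos_of_nonneg_of_nonpos p3.le ?_) zero_le_one
      have : 1 ≤ s ^ ((k : ℝ) - b) := Real.one_le_rpow hs.le (by linarith)
      nlinarith

/-- A lower bound on the upper tail of a sum of independent Bernoulli variables, by exponential
tilting. -/
lemma evolve_tail_le {m : ℕ} {p : ℕ → ℝ} {N : ℕ} (h : ∀ j, N ≤ j → 0 ≤ p j ∧ p j ≤ 1) (d : ℕ)
    {t s a b : ℝ} (ht : 1 ≤ t) (hs : 1 < s) :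
    evolve m p N d (fun k => if (k : ℝ) < a then 1 else 0) 0 ≤
      1 - t ^ (-b) * (evolve m p N d (fun k => t ^ k) 0
        - s ^ (-b) * evolve m p N d (fun k => (t * s) ^ k) 0
        - s ^ a * evolve m p N d (fun k => (t / s) ^ k) 0) := by
  have key : (fun k : ℕ => if (k : ℝ) < a then (1 : ℝ) else 0) ≤
      1 - t ^ (-b) • ((fun k : ℕ => t ^ k) - s ^ (-b) • (fun k : ℕ => (t * s) ^ k)
        - s ^ a • fun k : ℕ => (t / s) ^ k) := fun k => by
    have := exp_comb_le_indicator (a := a) (b := b) ht hs k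
    simp only [Pi.sub_apply, Pi.one_apply, Pi.smul_apply, smul_eq_mul]
    split_ifs at this ⊢ <;> linarith
  have := evolve_mono (m := m) h d key 0
  simpa only [map_sub, map_smul, evolve_one, Pi.sub_apply, Pi.one_apply, Pi.smul_apply,
    smul_eq_mul] using this

/-! ### Negative dependence of the counts of a multinomial sample -/

/-- The left side corresponds to at most one index being hit, the right side to independent hits.
Adding an index c leaves the excess p c * d c * (∏ (h + p d) - ∏ h), which is nonnegative because
all d have the same sign. -/
lemma prod_add_sum_le_prod {ι : Type*} [DecidableEq ι] (B : Finset ι) {h d p : ι → ℝ}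
    (hh : ∀ i ∈ B, 0 ≤ h i) (hp : ∀ i ∈ B, 0 ≤ p i) (hd : ∀ i ∈ B, 0 ≤ h i + p i * d i)
    (hs : (∀ i ∈ B, 0 ≤ d i) ∨ ∀ i ∈ B, d i ≤ 0) :
    ∏ i ∈ B, h i + ∑ v ∈ B, p v * (d v * ∏ i ∈ B.erase v, h i) ≤ ∏ i ∈ B, (h i + p i * d i) := by
  induction B using Finset.induction_on with
  | empty => simp
  | insert c B hc ih =>
    have e : ∑ v ∈ B, p v * (d v * ∏ i ∈ (insert c B).erase v, h i) =
        h c * ∑ v ∈ B, p v * (d v * ∏ i ∈ B.erase v, h i) := by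
      rw [Finset.mul_sum]
      refine Finset.sum_congr rfl fun v hv => ?_
      have hcv : c ≠ v := fun h => hc (h ▸ hv)
      rw [Finset.erase_insert_of_ne hcv, Finset.prod_insert (by simp [hc])]
      ring
    simp only [Finset.mem_insert, forall_eq_or_imp] at hh hp hd hs
    rw [Finset.prod_insert hc, Finset.prod_insert hc, Finset.sum_insert hc, e,
      Finset.erase_insert hc]
    have ih' := ih hh.2 hp.2 hd.2 (hs.imp And.right And.right)
    have h3 := mul_le_mul_of_nonneg_left ih' hh.1
    have h4 : 0 ≤ d c * (∏ i ∈ B, (h i + p i * d i) - ∏ i ∈ B, h i) := by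
      rcases hs with hs | hs
      · refine mul_nonneg hs.1 (sub_nonneg.2 (Finset.prod_le_prod hh.2 fun i hi => ?_))
        nlinarith [hs.2 i hi, hp.2 i hi]
      · refine mul_nonneg_of_nonpos_of_nonpos hs.1
          (sub_nonpos.2 (Finset.prod_le_prod hd.2 fun i hi => ?_))
        nlinarith [hs.2 i hi, hp.2 i hi]
    nlinarith [mul_nonneg hp.1 h4]

/-- Conditional expectation of a product of functions of the counts, for one draw. -/
lemma sum_draw_le {s B : Finset ℕ} (hB : B ⊆ s) {w : ℕ → ℝ} (hw : ∀ i ∈ s, 0 ≤ w i)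
    (hw1 : ∑ i ∈ s, w i = 1) {f : ℕ → ℕ → ℝ} (hf : ∀ i ∈ B, 0 ≤ f i)
    (hmon : (∀ i ∈ B, Monotone (f i)) ∨ ∀ i ∈ B, Antitone (f i)) (z : ℕ → ℕ) :
    ∑ v ∈ s, w v * ∏ i ∈ B, f i (z i + if v = i then 1 else 0) ≤
      ∏ i ∈ B, bernStep (w i) (f i) (z i) := by
  have hle : ∀ i ∈ s, w i ≤ 1 := fun i hi => hw1 ▸ Finset.single_le_sum hw hi
  -- A draw v changes only the factor of v, and only if v ∈ B.
  have e : ∀ v ∈ s, w v * ∏ i ∈ B, f i (z i + if v = i then 1 else 0) =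
      w v * ∏ i ∈ B, f i (z i) + if v ∈ B then w v * ((f v (z v + 1) - f v (z v)) *
        ∏ i ∈ B.erase v, f i (z i)) else 0 := by
    intro v _
    split_ifs with hv
    · rw [← Finset.mul_prod_erase B _ hv, ← Finset.mul_prod_erase B (fun i => f i (z i)) hv]
      have : ∏ i ∈ B.erase v, f i (z i + if v = i then 1 else 0) = ∏ i ∈ B.erase v, f i (z i) :=
        Finset.prod_congr rfl fun i hi => by rw [if_neg (Finset.ne_of_mem_erase hi).symm]; rfl
      rw [this, if_pos rfl]
      ring
    · rw [add_zero]
      congr 1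
      exact Finset.prod_congr rfl fun i hi => by
        rw [if_neg (fun h : v = i => hv (h ▸ hi))]; rfl
  rw [Finset.sum_congr rfl e, Finset.sum_add_distrib, ← Finset.sum_mul, hw1, one_mul,
    ← Finset.sum_filter, Finset.filter_mem_eq_inter, Finset.inter_eq_right.2 hB]
  have e2 : ∏ i ∈ B, bernStep (w i) (f i) (z i) =
      ∏ i ∈ B, (f i (z i) + w i * (f i (z i + 1) - f i (z i))) :=
    Finset.prod_congr rfl fun i _ => by rw [bernStep_apply]; ring
  rw [e2]
  refine prod_add_sum_le_prod B (fun i hi => hf i hi _) (fun i hi => hw i (hB hi)) (fun i hi => ?_)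
    (hmon.imp (fun h i hi => ?_) fun h i hi => ?_)
  · have := bernStep_nonneg (hw i (hB hi)) (hle i (hB hi)) (hf i hi) (z i)
    rw [bernStep_apply] at this
    simp only [Pi.zero_apply] at this
    linarith
  · exact sub_nonneg.2 (h i hi (Nat.le_succ _))
  · exact sub_nonpos.2 (h i hi (Nat.le_succ _))

/-- The number of coordinates of `a` that are equal to `i`. -/
def count {m : ℕ} (a : Fin m → ℕ) (i : ℕ) : ℕ := (Finset.univ.filter fun k => a k = i).card

lemma count_cons {m : ℕ} (v : ℕ) (a : Fin m → ℕ) (i : ℕ) :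
    count (Fin.cons v a : Fin (m + 1) → ℕ) i = (if v = i then 1 else 0) + count a i := by
  simp only [count, Finset.card_filter, Fin.sum_univ_succ, Fin.cons_zero, Fin.cons_succ]

lemma sum_piFinset_succ {m : ℕ} (s : Finset ℕ) (F : (Fin (m + 1) → ℕ) → ℝ) :
    ∑ a ∈ Fintype.piFinset (fun _ : Fin (m + 1) => s), F a =
      ∑ v ∈ s, ∑ a ∈ Fintype.piFinset (fun _ : Fin m => s), F (Fin.cons v a) := by
  rw [← Finset.sum_product']
  refine (Finset.sum_nbij' (fun q => Fin.cons q.1 q.2) (fun a => (a 0, Fin.tail a))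
    ?_ ?_ ?_ ?_ ?_).symm
  · rintro ⟨v, a⟩ h
    simp only [Finset.mem_product, Fintype.mem_piFinset] at h ⊢
    refine Fin.cases ?_ fun k => ?_
    · simpa using h.1
    · simpa using h.2 k
  · intro a h
    simp only [Finset.mem_product, Fintype.mem_piFinset, Fin.tail] at h ⊢
    exact ⟨h 0, fun k => h _⟩
  · rintro ⟨v, a⟩ _; simp
  · intro a _; simp
  · intro a _; rfl

/-- Conditional expectation of a product of functions of the counts, for `m` independent draws. -/
lemma sum_draws_le {s B : Finset ℕ} (hB : B ⊆ s) {w : ℕ → ℝ} (hw : ∀ i ∈ s, 0 ≤ w i)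
    (hw1 : ∑ i ∈ s, w i = 1) (m : ℕ) {f : ℕ → ℕ → ℝ} (hf : ∀ i ∈ B, 0 ≤ f i)
    (hmon : (∀ i ∈ B, Monotone (f i)) ∨ ∀ i ∈ B, Antitone (f i)) (z : ℕ → ℕ) :
    ∑ a ∈ Fintype.piFinset (fun _ : Fin m => s),
        (∏ k, w (a k)) * ∏ i ∈ B, f i (z i + count a i) ≤
      ∏ i ∈ B, (bernStep (w i) ^ m) (f i) (z i) := by
  have hle : ∀ i ∈ s, w i ≤ 1 := fun i hi => hw1 ▸ Finset.single_le_sum hw hi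
  induction m generalizing z with
  | zero => simp [count]
  | succ m ih =>
    -- The first draw is split off. Induction from the shifted counts handles the others, so the
    -- single-draw bound is applied to functions already averaged m times.
    rw [sum_piFinset_succ]
    calc _ = ∑ v ∈ s, w v * ∑ a ∈ Fintype.piFinset (fun _ : Fin m => s),
          (∏ k, w (a k)) * ∏ i ∈ B, f i (z i + (if v = i then 1 else 0) + count a i) := by
          refine Finset.sum_congr rfl fun v _ => ?_
          rw [Finset.mul_sum]
          refine Finset.sum_congr rfl fun a _ => ?_
          simp only [Fin.prod_univ_succ, Fin.cons_zero, Fin.cons_succ, count_cons, add_assoc,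
            mul_assoc]
      _ ≤ ∑ v ∈ s, w v * ∏ i ∈ B, (bernStep (w i) ^ m) (f i) (z i + if v = i then 1 else 0) := by
          refine Finset.sum_le_sum fun v hv => mul_le_mul_of_nonneg_left ?_ (hw v hv)
          exact ih (fun i => z i + if v = i then 1 else 0)
      _ ≤ ∏ i ∈ B, bernStep (w i) ((bernStep (w i) ^ m) (f i)) (z i) := by
          refine sum_draw_le hB hw hw1 (fun i hi => ?_) (hmon.imp (fun h i hi => ?_)
            fun h i hi => ?_) z
          · exact bernStep_pow_induction
              (fun _ hg => bernStep_nonneg (hw i (hB hi)) (hle i (hB hi)) hg) m (hf i hi)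
          · exact bernStep_pow_induction
              (fun _ hg => bernStep_monotone (hw i (hB hi)) (hle i (hB hi)) hg) m (h i hi)
          · exact bernStep_pow_induction
              (fun _ hg => bernStep_antitone (hw i (hB hi)) (hle i (hB hi)) hg) m (h i hi)
      _ = _ := by
          refine Finset.prod_congr rfl fun i _ => ?_
          rw [pow_succ', Module.End.mul_apply]

end WRG

namespace WRG
variable {Ω : Type*}

/-! ### The evolution of the in-degrees -/

/-- The σ-algebra generated by the vertex-weights. -/
abbrev weightAlgebra (W : ℕ → Ω → ℝ) : MeasurableSpace Ω :=
  ⨆ i ∈ Set.Ici 1, MeasurableSpace.comap (W i) inferInstance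

lemma measurable_weightAlgebra (W : ℕ → Ω → ℝ) {i : ℕ} (hi : 1 ≤ i) :
    Measurable[weightAlgebra W] (W i) :=
  (comap_measurable (W i)).mono
    (le_iSup₂ (f := fun i (_ : i ∈ Set.Ici 1) => MeasurableSpace.comap (W i) inferInstance) i hi)
    le_rfl

lemma measurable_totalWeight (W : ℕ → Ω → ℝ) (n : ℕ) :
    Measurable[weightAlgebra W] (totalWeight W n) := by
  unfold totalWeight
  exact Finset.measurable_sum _ fun i hi =>
    measurable_weightAlgebra W (Finset.mem_Icc.1 hi).1

lemma weightAlgebra_le_history {m : ℕ} (W : ℕ → Ω → ℝ) (T : ℕ → Fin m → Ω → ℕ) (n : ℕ) :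
    weightAlgebra W ≤ history W T n := le_sup_left

lemma measurable_target_history {m : ℕ} (W : ℕ → Ω → ℝ) (T : ℕ → Fin m → Ω → ℕ) {n j : ℕ}
    (hj : j ∈ Set.Icc 2 n) (k : Fin m) : Measurable[history W T n] (T j k) :=
  (comap_measurable (T j k)).mono
    (((le_iSup (fun k : Fin m => MeasurableSpace.comap (T j k) inferInstance) k).trans
      (le_iSup₂ (f := fun j (_ : j ∈ Set.Icc 2 n) =>
        ⨆ k : Fin m, MeasurableSpace.comap (T j k) inferInstance) j hj)).trans le_sup_right)
    le_rfl

lemma measurable_inDegree {m : ℕ} (W : ℕ → Ω → ℝ) (T : ℕ → Fin m → Ω → ℕ) (n i : ℕ) :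
    Measurable[history W T n] (inDegree T n i) := by
  unfold inDegree
  simp only [Finset.card_filter]
  refine Finset.measurable_sum _ fun e he => ?_
  have he' : e.1 ∈ Set.Icc 2 n := by simpa using he
  refine Measurable.ite ?_ measurable_const measurable_const
  exact measurable_target_history W T he' e.2 (measurableSet_singleton i)

lemma inDegree_succ {m : ℕ} (T : ℕ → Fin m → Ω → ℕ) {n : ℕ} (hn : 1 ≤ n) (i : ℕ) (ω : Ω) :
    inDegree T (n + 1) i ω = inDegree T n i ω + count (fun k => T (n + 1) k ω) i := by
  unfold inDegree count
  simp only [Finset.card_filter, Finset.sum_product]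
  rw [← Finset.insert_Icc_right_eq_Icc_add_one (by omega), Finset.sum_insert (by simp), add_comm]

lemma inDegree_mono {m : ℕ} (T : ℕ → Fin m → Ω → ℕ) {n n' : ℕ} (h : n ≤ n') (i : ℕ) (ω : Ω) :
    inDegree T n i ω ≤ inDegree T n' i ω := by
  unfold inDegree
  gcongr

variable {m : ℕ} {W : ℕ → Ω → ℝ} {T : ℕ → Fin m → Ω → ℕ}

lemma totalWeight_pos {n : ℕ} (hn : 1 ≤ n) {ω : Ω} (hω : ∀ i, 1 ≤ i → 0 < W i ω) :
    0 < totalWeight W n ω :=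
  Finset.sum_pos (fun i hi => hω i (Finset.mem_Icc.1 hi).1) ⟨1, by simpa using hn⟩

lemma sum_div_totalWeight {n : ℕ} (hn : 1 ≤ n) {ω : Ω} (hω : ∀ i, 1 ≤ i → 0 < W i ω) :
    ∑ i ∈ Finset.Icc 1 n, W i ω / totalWeight W n ω = 1 := by
  rw [← Finset.sum_div]
  exact div_self (totalWeight_pos hn hω).ne'

lemma sum_prod_div_totalWeight {n : ℕ} (hn : 1 ≤ n) {ω : Ω} (hω : ∀ i, 1 ≤ i → 0 < W i ω) :
    ∑ a ∈ Fintype.piFinset (fun _ : Fin m => Finset.Icc 1 n),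
      ∏ k, W (a k) ω / totalWeight W n ω = 1 := by
  rw [← Finset.prod_univ_sum (fun _ => Finset.Icc 1 n) fun _ i => W i ω / totalWeight W n ω]
  simp [sum_div_totalWeight hn hω]

lemma measurable_apply_nat {m0 : MeasurableSpace Ω} {F : Ω → ℕ → ℝ}
    (hF : ∀ k, Measurable fun ω => F ω k) {Z : Ω → ℕ} (hZ : Measurable Z) :
    Measurable fun ω => F ω (Z ω) :=
  (measurable_from_prod_countable_left (f := fun q : Ω × ℕ => F q.1 q.2) hF).comp
    (measurable_id.prodMk hZ)

lemma measurable_bernStep_pow {m0 : MeasurableSpace Ω} {p : Ω → ℝ} (hp : Measurable p)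
    {F : Ω → ℕ → ℝ} (hF : ∀ k, Measurable fun ω => F ω k) (m k : ℕ) :
    Measurable fun ω => (bernStep (p ω) ^ m) (F ω) k := by
  induction m generalizing k with
  | zero => simpa using hF k
  | succ m ih =>
    simp only [pow_succ', Module.End.mul_apply, bernStep_apply]
    exact ((measurable_const.sub hp).mul (ih k)).add (hp.mul (ih (k + 1)))

lemma div_totalWeight_mem {n i : ℕ} (hi : i ∈ Finset.Icc 1 n) {ω : Ω}
    (hω : ∀ i, 1 ≤ i → 0 < W i ω) :
    0 ≤ W i ω / totalWeight W n ω ∧ W i ω / totalWeight W n ω ≤ 1 := by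
  have hi' := Finset.mem_Icc.1 hi
  have hS := totalWeight_pos (hi'.1.trans hi'.2) hω
  refine ⟨div_nonneg (hω i hi'.1).le hS.le, (div_le_one hS).2 ?_⟩
  exact Finset.single_le_sum (f := fun i => W i ω)
    (fun j hj => (hω j (Finset.mem_Icc.1 hj).1).le) hi

variable [mΩ : MeasurableSpace Ω] {μ : Measure Ω} {ν : Measure ℝ}

lemma IsWRG.weightAlgebra_le (h : IsWRG μ ν m W T) : weightAlgebra W ≤ mΩ :=
  iSup₂_le fun i hi => (h.measurable_weight i hi).comap_le

lemma IsWRG.history_le (h : IsWRG μ ν m W T) (n : ℕ) : history W T n ≤ mΩ :=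
  sup_le h.weightAlgebra_le
    (iSup₂_le fun j hj => iSup_le fun k => (h.measurable_target j hj.1 k).comap_le)

lemma IsWRG.ae_weight (h : IsWRG μ ν m W T) {P : ℝ → Prop} (hP : ∀ᵐ x ∂ν, P x) :
    ∀ᵐ ω ∂μ, ∀ i, 1 ≤ i → P (W i ω) := by
  rw [ae_all_iff]
  intro i
  by_cases hi : 1 ≤ i
  · rw [← h.weight_law i hi] at hP
    filter_upwards [ae_of_ae_map (h.measurable_weight i hi).aemeasurable hP] with ω hω _ using hω
  · exact Eventually.of_forall fun ω h => absurd h hi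

lemma IsWRG.measurableSet_draw (h : IsWRG μ ν m W T) {n : ℕ} (hn : 1 ≤ n) (a : Fin m → ℕ) :
    MeasurableSet {ω | ∀ k, T (n + 1) k ω = a k} := by
  rw [Set.ofPred_forall]
  exact MeasurableSet.iInter fun k =>
    h.measurable_target (n + 1) (by omega) k (measurableSet_singleton _)

lemma IsWRG.measurable_draw_density (h : IsWRG μ ν m W T) {n : ℕ} {a : Fin m → ℕ}
    (ha : ∀ k, a k ∈ Finset.Icc 1 n) :
    Measurable fun ω => ENNReal.ofReal (∏ k, W (a k) ω / totalWeight W n ω) := by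
  refine ENNReal.measurable_ofReal.comp (Finset.measurable_prod _ fun k _ => Measurable.div ?_ ?_)
  · exact h.measurable_weight _ (Finset.mem_Icc.1 (ha k)).1
  · exact (measurable_totalWeight W n).mono h.weightAlgebra_le le_rfl

/-- The conditional law of the targets of vertex `n + 1`, at a single value. -/
lemma IsWRG.measure_inter_draw [IsProbabilityMeasure μ] (h : IsWRG μ ν m W T)
    (hpos : ∀ᵐ ω ∂μ, ∀ i, 1 ≤ i → 0 < W i ω) {n : ℕ} (hn : 1 ≤ n) {a : Fin m → ℕ}
    (ha : ∀ k, a k ∈ Finset.Icc 1 n) {E : Set Ω} (hE : MeasurableSet[history W T n] E) :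
    μ (E ∩ {ω | ∀ k, T (n + 1) k ω = a k}) =
      ∫⁻ ω in E, ENNReal.ofReal (∏ k, W (a k) ω / totalWeight W n ω) ∂μ := by
  have hD := h.measurableSet_draw hn a
  have hc := h.target_condProb n hn a ha
  have hi : Integrable (fun ω => ∏ k, W (a k) ω / totalWeight W n ω) μ :=
    integrable_condExp.congr hc
  have h1 := setIntegral_condExp (μ := μ) (h.history_le n)
    (f := {ω | ∀ k, T (n + 1) k ω = a k}.indicator fun _ => (1 : ℝ))
    ((integrable_const 1).indicator hD) hE
  rw [setIntegral_congr_ae (h.history_le n E hE) (hc.mono fun ω hω _ => hω),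
    integral_indicator hD, Measure.restrict_restrict hD, setIntegral_const, smul_eq_mul, mul_one,
    Set.inter_comm] at h1
  rw [← ofReal_integral_eq_lintegral_ofReal hi.integrableOn, h1, ofReal_measureReal]
  refine ae_restrict_of_ae ?_
  filter_upwards [hpos] with ω hω
  exact Finset.prod_nonneg fun k _ => div_nonneg (hω _ (Finset.mem_Icc.1 (ha k)).1).le
    (totalWeight_pos hn hω).le

/-- The restriction of μ to the draw event and μ weighted by the conditional probability agree on
the history, hence have the same integrals of history-measurable functions. -/
lemma IsWRG.lintegral_draw_eq [IsProbabilityMeasure μ] (h : IsWRG μ ν m W T)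
    (hpos : ∀ᵐ ω ∂μ, ∀ i, 1 ≤ i → 0 < W i ω) {n : ℕ} (hn : 1 ≤ n) {a : Fin m → ℕ}
    (ha : ∀ k, a k ∈ Finset.Icc 1 n) {G : Ω → ENNReal} (hG : Measurable[history W T n] G) :
    ∫⁻ ω in {ω | ∀ k, T (n + 1) k ω = a k}, G ω ∂μ =
      ∫⁻ ω, ENNReal.ofReal (∏ k, W (a k) ω / totalWeight W n ω) * G ω ∂μ := by
  have hm := h.history_le n
  have hg := h.measurable_draw_density ha
  have key : (μ.restrict {ω | ∀ k, T (n + 1) k ω = a k}).trim hm =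
      (μ.withDensity fun ω => ENNReal.ofReal (∏ k, W (a k) ω / totalWeight W n ω)).trim hm := by
    refine @Measure.ext _ (history W T n) _ _ fun E hE => ?_
    rw [trim_measurableSet_eq hm hE, trim_measurableSet_eq hm hE, withDensity_apply _ (hm E hE),
      Measure.restrict_apply (hm E hE), h.measure_inter_draw hpos hn ha hE]
  rw [← lintegral_trim hm hG, key, lintegral_trim hm hG,
    lintegral_withDensity_eq_lintegral_mul _ hg (hG.mono hm le_rfl)]
  rfl

/-- The targets of a vertex are earlier vertices. -/
lemma IsWRG.ae_target_mem [IsProbabilityMeasure μ] (h : IsWRG μ ν m W T)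
    (hpos : ∀ᵐ ω ∂μ, ∀ i, 1 ≤ i → 0 < W i ω) {n : ℕ} (hn : 1 ≤ n) :
    ∀ᵐ ω ∂μ, ∀ k, T (n + 1) k ω ∈ Finset.Icc 1 n := by
  have hD := fun a => h.measurableSet_draw hn a
  set P := Fintype.piFinset (fun _ : Fin m => Finset.Icc 1 n) with hP
  have e : {ω | ∀ k, T (n + 1) k ω ∈ Finset.Icc 1 n} =
      ⋃ a ∈ P, {ω | ∀ k, T (n + 1) k ω = a k} := by
    ext ω
    simp only [Set.mem_ofPred_eq, Set.mem_iUnion, exists_prop, hP, Fintype.mem_piFinset]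
    refine ⟨fun H => ⟨fun k => T (n + 1) k ω, H, fun _ => rfl⟩, ?_⟩
    rintro ⟨a, ha, H⟩ k
    rw [H]; exact ha k
  have hmeas : MeasurableSet {ω | ∀ k, T (n + 1) k ω ∈ Finset.Icc 1 n} := by
    rw [e]; exact P.measurableSet_biUnion fun a _ => hD a
  change {ω | ∀ k, T (n + 1) k ω ∈ Finset.Icc 1 n} ∈ ae μ
  -- The conditional law is prescribed only at tuples in {1, …, n}; these already carry total mass
  -- one, so no other tuple occurs.
  rw [mem_ae_iff_prob_eq_one hmeas, e, measure_biUnion_finset ?_ fun a _ => hD a]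
  · have : ∀ a ∈ P, μ {ω | ∀ k, T (n + 1) k ω = a k} =
        ∫⁻ ω, ENNReal.ofReal (∏ k, W (a k) ω / totalWeight W n ω) ∂μ := fun a ha => by
      have := h.measure_inter_draw hpos hn (Fintype.mem_piFinset.1 ha) MeasurableSet.univ
      simpa using this
    rw [Finset.sum_congr rfl this, ← lintegral_finsetSum _ fun a ha =>
      h.measurable_draw_density (Fintype.mem_piFinset.1 ha)]
    have e1 : ∀ᵐ ω ∂μ, ∑ a ∈ P, ENNReal.ofReal (∏ k, W (a k) ω / totalWeight W n ω) = 1 := by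
      filter_upwards [hpos] with ω hω
      rw [← ENNReal.ofReal_sum_of_nonneg, sum_prod_div_totalWeight hn hω, ENNReal.ofReal_one]
      exact fun a ha => Finset.prod_nonneg fun k _ => div_nonneg
        (hω _ (Finset.mem_Icc.1 (Fintype.mem_piFinset.1 ha k)).1).le (totalWeight_pos hn hω).le
    rw [lintegral_congr_ae e1]
    simp
  · intro a _ b _ hab
    refine Set.disjoint_left.2 fun ω h1 h2 => hab (funext fun k => ?_)
    rw [← h1 k, ← h2 k]

/-- Averaging over the targets of vertex `n + 1`. -/
lemma IsWRG.lintegral_draw [IsProbabilityMeasure μ] (h : IsWRG μ ν m W T)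
    (hpos : ∀ᵐ ω ∂μ, ∀ i, 1 ≤ i → 0 < W i ω) {n : ℕ} (hn : 1 ≤ n)
    {G : (Fin m → ℕ) → Ω → ENNReal} (hG : ∀ a, Measurable[history W T n] (G a)) :
    ∫⁻ ω, G (fun k => T (n + 1) k ω) ω ∂μ =
      ∫⁻ ω, ∑ a ∈ Fintype.piFinset (fun _ : Fin m => Finset.Icc 1 n),
        ENNReal.ofReal (∏ k, W (a k) ω / totalWeight W n ω) * G a ω ∂μ := by
  have hD := fun a => h.measurableSet_draw hn a
  set P := Fintype.piFinset (fun _ : Fin m => Finset.Icc 1 n) with hP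
  have e : ∀ᵐ ω ∂μ, G (fun k => T (n + 1) k ω) ω =
      ∑ a ∈ P, {ω | ∀ k, T (n + 1) k ω = a k}.indicator (G a) ω := by
    filter_upwards [h.ae_target_mem hpos hn] with ω hω
    rw [Finset.sum_eq_single_of_mem (fun k => T (n + 1) k ω) (Fintype.mem_piFinset.2 hω)]
    · simp
    · intro a _ ha
      exact Set.indicator_of_notMem (fun H => ha (funext fun k => (H k).symm)) _
  have hm := h.history_le n
  rw [lintegral_congr_ae e, lintegral_finsetSum, lintegral_finsetSum]
  · refine Finset.sum_congr rfl fun a ha => ?_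
    rw [lintegral_indicator (hD a)]
    exact h.lintegral_draw_eq hpos hn (Fintype.mem_piFinset.1 ha) (hG a)
  · exact fun a ha => (h.measurable_draw_density (Fintype.mem_piFinset.1 ha)).mul
      ((hG a).mono hm le_rfl)
  · exact fun a _ => ((hG a).mono hm le_rfl).indicator (hD a)

/-- One step of the product supermartingale. -/
lemma IsWRG.lintegral_step_le [IsProbabilityMeasure μ] (h : IsWRG μ ν m W T)
    (hpos : ∀ᵐ ω ∂μ, ∀ i, 1 ≤ i → 0 < W i ω) {n : ℕ} (hn : 1 ≤ n) {B : Finset ℕ}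
    (hB : B ⊆ Finset.Icc 1 n) {A : Set Ω} (hA : MeasurableSet[weightAlgebra W] A)
    (hAp : ∀ ω ∈ A, ∀ i, 1 ≤ i → 0 < W i ω) {F : ℕ → Ω → ℕ → ℝ}
    (hF : ∀ i ∈ B, ∀ k, Measurable[weightAlgebra W] fun ω => F i ω k)
    (hF0 : ∀ ω ∈ A, ∀ i ∈ B, 0 ≤ F i ω)
    (hmon : ∀ ω ∈ A, (∀ i ∈ B, Monotone (F i ω)) ∨ ∀ i ∈ B, Antitone (F i ω)) :
    ∫⁻ ω in A, ENNReal.ofReal (∏ i ∈ B, F i ω (inDegree T (n + 1) i ω)) ∂μ ≤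
      ∫⁻ ω in A, ENNReal.ofReal (∏ i ∈ B,
        (bernStep (W i ω / totalWeight W n ω) ^ m) (F i ω) (inDegree T n i ω)) ∂μ := by
  have hAm := h.weightAlgebra_le A hA
  have hwh := weightAlgebra_le_history W T n
  -- The restriction to A becomes an indicator in the integrand, which is history-measurable since A
  -- depends on the weights only.
  rw [← lintegral_indicator hAm, ← lintegral_indicator hAm]
  have e := h.lintegral_draw hpos hn (G := fun a => A.indicator fun ω =>
    ENNReal.ofReal (∏ i ∈ B, F i ω (inDegree T n i ω + count a i))) (fun a => by
      refine Measurable.indicator ?_ (hwh A hA)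
      refine ENNReal.measurable_ofReal.comp (Finset.measurable_prod _ fun i hi => ?_)
      exact measurable_apply_nat (fun k => (hF i hi k).mono hwh le_rfl)
        ((measurable_inDegree W T n i).add_const _))
  have e2 : ∀ ω, A.indicator (fun ω => ENNReal.ofReal
      (∏ i ∈ B, F i ω (inDegree T (n + 1) i ω))) ω = A.indicator (fun ω' => ENNReal.ofReal
      (∏ i ∈ B, F i ω' (inDegree T n i ω' + count (fun k => T (n + 1) k ω) i))) ω := fun ω => by
    simp only [Set.indicator, inDegree_succ T hn]
  rw [lintegral_congr e2, e]
  refine lintegral_mono fun ω => ?_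
  by_cases hω : ω ∈ A
  · simp only [Set.indicator_of_mem hω]
    have hp := hAp ω hω
    have hw : ∀ i ∈ Finset.Icc 1 n, 0 ≤ W i ω / totalWeight W n ω := fun i hi =>
      div_nonneg (hp i (Finset.mem_Icc.1 hi).1).le (totalWeight_pos hn hp).le
    have hprod : ∀ a ∈ Fintype.piFinset (fun _ : Fin m => Finset.Icc 1 n),
        0 ≤ ∏ k, W (a k) ω / totalWeight W n ω := fun a ha =>
      Finset.prod_nonneg fun k _ => hw _ (Fintype.mem_piFinset.1 ha k)
    rw [Finset.sum_congr rfl fun a ha => (ENNReal.ofReal_mul (hprod a ha)).symm,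
      ← ENNReal.ofReal_sum_of_nonneg]
    · exact ENNReal.ofReal_le_ofReal (sum_draws_le hB hw (sum_div_totalWeight hn hp) m
        (hF0 ω hω) (hmon ω hω) fun i => inDegree T n i ω)
    · exact fun a ha => mul_nonneg (hprod a ha)
        (Finset.prod_nonneg fun i hi => hF0 ω hω i hi _)
  · simp [Set.indicator_of_notMem hω]

/-- The product supermartingale between times `N` and `N + d`: given the weights, the in-degrees
of the vertices in `B` are dominated by independent sums of Bernoulli variables. -/
lemma IsWRG.lintegral_evolve_le [IsProbabilityMeasure μ] (h : IsWRG μ ν m W T)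
    (hpos : ∀ᵐ ω ∂μ, ∀ i, 1 ≤ i → 0 < W i ω) {N : ℕ} (hN : 1 ≤ N) (d : ℕ) {B : Finset ℕ}
    (hB : B ⊆ Finset.Icc 1 N) {A : Set Ω} (hA : MeasurableSet[weightAlgebra W] A)
    (hAp : ∀ ω ∈ A, ∀ i, 1 ≤ i → 0 < W i ω) {F : ℕ → Ω → ℕ → ℝ}
    (hF : ∀ i ∈ B, ∀ k, Measurable[weightAlgebra W] fun ω => F i ω k)
    (hF0 : ∀ ω ∈ A, ∀ i ∈ B, 0 ≤ F i ω)
    (hmon : ∀ ω ∈ A, (∀ i ∈ B, Monotone (F i ω)) ∨ ∀ i ∈ B, Antitone (F i ω)) :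
    ∫⁻ ω in A, ENNReal.ofReal (∏ i ∈ B, F i ω (inDegree T (N + d) i ω)) ∂μ ≤
      ∫⁻ ω in A, ENNReal.ofReal (∏ i ∈ B,
        evolve m (fun j => W i ω / totalWeight W j ω) N d (F i ω) (inDegree T N i ω)) ∂μ := by
  induction d generalizing F with
  | zero => simp [evolve_zero]
  | succ d ih =>
    have hB' : B ⊆ Finset.Icc 1 (N + d) :=
      hB.trans (Finset.Icc_subset_Icc_right (Nat.le_add_right _ _))
    -- The last time step is averaged out first. The averaged functions depend on the weights, which
    -- is why F may depend on ω.
    refine (h.lintegral_step_le hpos (hN.trans (Nat.le_add_right _ d)) hB' hA hAp hF hF0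
      hmon).trans ?_
    have hw : ∀ ω ∈ A, ∀ i ∈ B, 0 ≤ W i ω / totalWeight W (N + d) ω ∧
        W i ω / totalWeight W (N + d) ω ≤ 1 := fun ω hω i hi =>
      div_totalWeight_mem (hB' hi) (hAp ω hω)
    refine ih (F := fun i ω => (bernStep (W i ω / totalWeight W (N + d) ω) ^ m) (F i ω)) ?_ ?_ ?_
    · intro i hi k
      exact measurable_bernStep_pow ((measurable_weightAlgebra W (Finset.mem_Icc.1 (hB hi)).1).div
        (measurable_totalWeight W _)) (hF i hi) m k
    · intro ω hω i hi
      exact bernStep_pow_induction (P := fun f => 0 ≤ f)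
        (fun _ hg => bernStep_nonneg (hw ω hω i hi).1 (hw ω hω i hi).2 hg) m (hF0 ω hω i hi)
    · intro ω hω
      refine (hmon ω hω).imp (fun H i hi => ?_) fun H i hi => ?_
      · exact bernStep_pow_induction
          (fun _ hg => bernStep_monotone (hw ω hω i hi).1 (hw ω hω i hi).2 hg) m (H i hi)
      · exact bernStep_pow_induction
          (fun _ hg => bernStep_antitone (hw ω hω i hi).1 (hw ω hω i hi).2 hg) m (H i hi)

/-- A vertex has in-degree zero when it is added. -/
lemma IsWRG.ae_inDegree_self [IsProbabilityMeasure μ] (h : IsWRG μ ν m W T)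
    (hpos : ∀ᵐ ω ∂μ, ∀ i, 1 ≤ i → 0 < W i ω) :
    ∀ᵐ ω ∂μ, ∀ i, inDegree T i i ω = 0 := by
  have H : ∀ᵐ ω ∂μ, ∀ n, 1 ≤ n → ∀ k, T (n + 1) k ω ∈ Finset.Icc 1 n :=
    ae_all_iff.2 fun n => by
      by_cases hn : 1 ≤ n
      · filter_upwards [h.ae_target_mem hpos hn] with ω hω _ using hω
      · exact Eventually.of_forall fun ω h => absurd h hn
  filter_upwards [H] with ω hω i
  unfold inDegree
  rw [Finset.card_eq_zero, Finset.filter_eq_empty_iff]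
  -- The edges present start at vertices j ≤ i, and their targets are below j.
  rintro ⟨j, k⟩ hj
  simp only [Finset.mem_product, Finset.mem_Icc, Finset.mem_univ, and_true] at hj
  obtain ⟨n, rfl⟩ : ∃ n, j = n + 1 := ⟨j - 1, by omega⟩
  have := Finset.mem_Icc.1 (hω n (by omega) k)
  simp only
  omega

end WRG

namespace WRG
variable {Ω : Type*}

/-! ### Typical behaviour of the weights -/

/-- Quantitative consequences of the strong law of large numbers for the weights, which hold for
some `K` almost surely. -/
structure GoodWeights (W : ℕ → Ω → ℝ) (c ε : ℝ) (K : ℕ) (ω : Ω) : Prop where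
  pos : ∀ i, 1 ≤ i → 0 < W i ω
  le_one : ∀ i, 1 ≤ i → W i ω ≤ 1
  sum_le : ∀ N n : ℕ, 1 ≤ N → N ≤ n → ∑ l ∈ Finset.Ico N n, (totalWeight W l ω)⁻¹ ≤
    (c⁻¹ + ε) * Real.log (n / N) + K
  le_sum : ∀ N n : ℕ, 1 ≤ N → N ≤ n → (c⁻¹ - ε) * Real.log (n / N) - K ≤
    ∑ l ∈ Finset.Ico N n, (totalWeight W l ω)⁻¹
  sum_sq_le : ∀ n : ℕ, ∑ l ∈ Finset.Ico 1 n, (totalWeight W l ω)⁻¹ ^ 2 ≤ K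
  le_count : ∀ N : ℕ, K ≤ N →
    (N : ℝ) ≤ K * ∑ i ∈ Finset.Icc 1 N, if 1 - ε ≤ W i ω then (1 : ℝ) else 0

/-- Measurability with respect to the weights alone lets the event serve as the set A of the product
supermartingale. -/
lemma measurableSet_goodWeights (W : ℕ → Ω → ℝ) (c ε : ℝ) (K : ℕ) :
    MeasurableSet[weightAlgebra W] {ω | GoodWeights W c ε K ω} := by
  have e : {ω | GoodWeights W c ε K ω} =
      {ω | ∀ i, 1 ≤ i → 0 < W i ω} ∩ ({ω | ∀ i, 1 ≤ i → W i ω ≤ 1} ∩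
      ({ω | ∀ N n : ℕ, 1 ≤ N → N ≤ n → ∑ l ∈ Finset.Ico N n, (totalWeight W l ω)⁻¹ ≤
        (c⁻¹ + ε) * Real.log (n / N) + K} ∩
      ({ω | ∀ N n : ℕ, 1 ≤ N → N ≤ n → (c⁻¹ - ε) * Real.log (n / N) - K ≤
        ∑ l ∈ Finset.Ico N n, (totalWeight W l ω)⁻¹} ∩
      ({ω | ∀ n : ℕ, ∑ l ∈ Finset.Ico 1 n, (totalWeight W l ω)⁻¹ ^ 2 ≤ K} ∩
      {ω | ∀ N : ℕ, K ≤ N →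
        (N : ℝ) ≤ K * ∑ i ∈ Finset.Icc 1 N, if 1 - ε ≤ W i ω then (1 : ℝ) else 0})))) := by
    ext ω
    exact ⟨fun h => ⟨h.1, h.2, h.3, h.4, h.5, h.6⟩, fun ⟨h1, h2, h3, h4, h5, h6⟩ =>
      ⟨h1, h2, h3, h4, h5, h6⟩⟩
  have hS : ∀ l, Measurable[weightAlgebra W] fun ω => (totalWeight W l ω)⁻¹ := fun l =>
    (measurable_totalWeight W l).inv
  rw [e]
  simp only [Set.ofPred_forall]
  refine .inter ?_ (.inter ?_ (.inter ?_ (.inter ?_ (.inter ?_ ?_))))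
  · exact .iInter fun i => .iInter fun hi =>
      measurableSet_lt measurable_const (measurable_weightAlgebra W hi)
  · exact .iInter fun i => .iInter fun hi =>
      measurableSet_le (measurable_weightAlgebra W hi) measurable_const
  · exact .iInter fun N => .iInter fun n => .iInter fun _ => .iInter fun _ =>
      measurableSet_le (Finset.measurable_sum _ fun l _ => hS l) measurable_const
  · exact .iInter fun N => .iInter fun n => .iInter fun _ => .iInter fun _ =>
      measurableSet_le measurable_const (Finset.measurable_sum _ fun l _ => hS l)
  · exact .iInter fun n =>
      measurableSet_le (Finset.measurable_sum _ fun l _ => (hS l).pow_const 2) measurable_const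
  · refine .iInter fun N => .iInter fun _ => measurableSet_le measurable_const
      (measurable_const.mul (Finset.measurable_sum _ fun i hi => ?_))
    exact Measurable.ite (measurableSet_le measurable_const
      (measurable_weightAlgebra W (Finset.mem_Icc.1 hi).1)) measurable_const measurable_const

/-! ### Harmonic sums, logarithms and consequences of the strong law -/

lemma log_succ_sub_log_le {n : ℕ} (hn : 1 ≤ n) :
    Real.log (n + 1 : ℕ) - Real.log n ≤ (n : ℝ)⁻¹ := by
  have h0 : (0 : ℝ) < n := by exact_mod_cast hn
  rw [← Real.log_div (by positivity) h0.ne']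
  have := Real.log_le_sub_one_of_pos (x := ((n + 1 : ℕ) : ℝ) / n) (by positivity)
  have e : ((n + 1 : ℕ) : ℝ) / n - 1 = (n : ℝ)⁻¹ := by push_cast; field_simp; ring
  linarith

lemma inv_succ_le_log_succ_sub_log {n : ℕ} (hn : 1 ≤ n) :
    ((n + 1 : ℕ) : ℝ)⁻¹ ≤ Real.log (n + 1 : ℕ) - Real.log n := by
  have h0 : (0 : ℝ) < n := by exact_mod_cast hn
  rw [← Real.log_div (by positivity) h0.ne']
  have := Real.one_sub_inv_le_log_of_pos (x := ((n + 1 : ℕ) : ℝ) / n) (by positivity)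
  have e : 1 - (((n + 1 : ℕ) : ℝ) / n)⁻¹ = ((n + 1 : ℕ) : ℝ)⁻¹ := by push_cast; field_simp; ring
  linarith

lemma log_div_le_sum_inv {N n : ℕ} (hN : 1 ≤ N) (hn : N ≤ n) :
    Real.log (n / N) ≤ ∑ l ∈ Finset.Ico N n, (l : ℝ)⁻¹ := by
  have h0 : (N : ℝ) ≠ 0 := by positivity
  rw [Real.log_div (by have := hN.trans hn; positivity) h0]
  induction n, hn using Nat.le_induction with
  | base => simp
  | succ n hn ih =>
    rw [Finset.sum_Ico_succ_top hn]
    linarith [log_succ_sub_log_le (hN.trans hn)]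

lemma sum_inv_le_log_div_add_one {N n : ℕ} (hN : 1 ≤ N) (hn : N ≤ n) :
    ∑ l ∈ Finset.Ico N n, (l : ℝ)⁻¹ ≤ Real.log (n / N) + 1 := by
  have h0 : (N : ℝ) ≠ 0 := by positivity
  have h1 : (N : ℝ)⁻¹ ≤ 1 := inv_le_one_of_one_le₀ (by exact_mod_cast hN)
  rw [Real.log_div (by have := hN.trans hn; positivity) h0]
  have key : ∑ l ∈ Finset.Ico N n, (l : ℝ)⁻¹ ≤
      Real.log n - Real.log N + (N : ℝ)⁻¹ - (n : ℝ)⁻¹ := by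
    induction n, hn using Nat.le_induction with
    | base => simp
    | succ n hn ih =>
      rw [Finset.sum_Ico_succ_top hn]
      linarith [inv_succ_le_log_succ_sub_log (hN.trans hn)]
  have : 0 ≤ (n : ℝ)⁻¹ := by positivity
  linarith

/-- Beyond some l0 each term errs by at most ε/l; the finitely many earlier terms cost a constant
independent of N and n. -/
lemma exists_sum_abs_sub_le {r : ℕ → ℝ} {b : ℝ}
    (h : Tendsto (fun l : ℕ => l * r l) atTop (𝓝 b)) {ε : ℝ} (hε : 0 < ε) :
    ∃ C, ∀ N n : ℕ, 1 ≤ N → N ≤ n → |∑ l ∈ Finset.Ico N n, r l - b * ∑ l ∈ Finset.Ico N n,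
      (l : ℝ)⁻¹| ≤ ε * ∑ l ∈ Finset.Ico N n, (l : ℝ)⁻¹ + C := by
  obtain ⟨l0, hl0⟩ := Metric.tendsto_atTop.1 h ε hε
  refine ⟨∑ l ∈ Finset.range l0, |r l - b * (l : ℝ)⁻¹|, fun N n hN _ => ?_⟩
  rw [Finset.mul_sum, ← Finset.sum_sub_distrib]
  refine (Finset.abs_sum_le_sum_abs _ _).trans ?_
  have key : ∀ l ∈ Finset.Ico N n, |r l - b * (l : ℝ)⁻¹| ≤
      ε * (l : ℝ)⁻¹ + if l < l0 then |r l - b * (l : ℝ)⁻¹| else 0 := fun l hl => by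
    have hl1 : (0 : ℝ) < l := by exact_mod_cast hN.trans (Finset.mem_Ico.1 hl).1
    split_ifs with hlt
    · have : 0 ≤ ε * (l : ℝ)⁻¹ := by positivity
      linarith
    · have := hl0 l (not_lt.1 hlt)
      rw [Real.dist_eq] at this
      have e : r l - b * (l : ℝ)⁻¹ = (l * r l - b) * (l : ℝ)⁻¹ := by field_simp
      rw [e, abs_mul, abs_of_pos (inv_pos.2 hl1), add_zero]
      gcongr
  refine (Finset.sum_le_sum key).trans ?_
  rw [Finset.sum_add_distrib, Finset.mul_sum, ← Finset.sum_filter]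
  gcongr
  intro l hl
  simpa using (Finset.mem_filter.1 hl).2

lemma exists_goodWeights {W : ℕ → Ω → ℝ} {c ε q : ℝ} {ω : Ω} (hc : 0 < c) (hε : 0 < ε) (hq : 0 < q)
    (hpos : ∀ i, 1 ≤ i → 0 < W i ω) (hle : ∀ i, 1 ≤ i → W i ω ≤ 1)
    (hS : Tendsto (fun n : ℕ => totalWeight W n ω / n) atTop (𝓝 c))
    (hcount : Tendsto (fun n : ℕ => (∑ i ∈ Finset.Icc 1 n,
      if 1 - ε ≤ W i ω then (1 : ℝ) else 0) / n) atTop (𝓝 q)) :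
    ∃ K, GoodWeights W c ε K ω := by
  have hr : Tendsto (fun l : ℕ => l * (totalWeight W l ω)⁻¹) atTop (𝓝 c⁻¹) := by
    refine (hS.inv₀ hc.ne').congr fun n => ?_
    rw [inv_div, div_eq_mul_inv]
  obtain ⟨C, hC⟩ := exists_sum_abs_sub_le hr hε
  obtain ⟨M, hM⟩ := hr.bddAbove_range
  have hM' : ∀ l : ℕ, l * (totalWeight W l ω)⁻¹ ≤ M := fun l => hM ⟨l, rfl⟩
  have hsq : Summable fun l : ℕ => M ^ 2 * ((l : ℝ) ^ 2)⁻¹ :=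
    (Real.summable_nat_pow_inv.2 one_lt_two).mul_left _
  obtain ⟨n0, hn0⟩ := eventually_atTop.1 (hcount.eventually_const_lt (half_lt_self hq))
  have hci : 0 < c⁻¹ := inv_pos.2 hc
  -- K collects the additive errors of the two logarithmic bounds, the bound on the squares, the
  -- inverse of half the density q, and the time after which that density is reached.
  obtain ⟨K, hK⟩ := exists_nat_ge (max (c⁻¹ + ε + C) (max (∑' l : ℕ, M ^ 2 * ((l : ℝ) ^ 2)⁻¹)
    (max (2 / q) (n0 + 1))))
  simp only [max_le_iff] at hK
  obtain ⟨hK1, hK2, hK3, hK4⟩ := hK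
  refine ⟨K, hpos, hle, fun N n hN hn => ?_, fun N n hN hn => ?_, fun n => ?_, fun N hN => ?_⟩
  · have h1 := (abs_le.1 (hC N n hN hn)).2
    have h2 := sum_inv_le_log_div_add_one hN hn
    have h3 := mul_le_mul_of_nonneg_left h2 (by positivity : 0 ≤ c⁻¹ + ε)
    linarith
  · have h1 := (abs_le.1 (hC N n hN hn)).1
    have h2 := sum_inv_le_log_div_add_one hN hn
    have h3 := mul_le_mul_of_nonneg_left h2 hε.le
    have h4 := mul_le_mul_of_nonneg_left (log_div_le_sum_inv hN hn) hci.le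
    linarith
  · refine le_trans ?_ ((hsq.sum_le_tsum (Finset.Ico 1 n) fun l _ => by positivity).trans hK2)
    refine Finset.sum_le_sum fun l hl => ?_
    have hl1 := (Finset.mem_Ico.1 hl).1
    have hl0 : (0 : ℝ) < l := by exact_mod_cast hl1
    have hSl := inv_pos.2 (totalWeight_pos hl1 hpos)
    rw [← inv_pow, ← mul_pow]
    refine pow_le_pow_left₀ hSl.le ?_ 2
    rw [← div_eq_mul_inv, le_div_iff₀ hl0, mul_comm]
    exact hM' l
  · have hN' : (n0 : ℝ) + 1 ≤ N := hK4.trans (by exact_mod_cast hN)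
    have hN1 : (0 : ℝ) < N := by linarith [Nat.cast_nonneg (α := ℝ) n0]
    have h1 := hn0 N (by exact_mod_cast (by linarith : (n0 : ℝ) ≤ N))
    rw [lt_div_iff₀ hN1] at h1
    have h2 : 2 / q * (q / 2 * N) = N := by field_simp
    have h3 : 2 / q * (q / 2 * N) ≤ K * (q / 2 * N) := by gcongr
    have h4 : (K : ℝ) * (q / 2 * N) ≤ K * ∑ i ∈ Finset.Icc 1 N,
      if 1 - ε ≤ W i ω then (1 : ℝ) else 0 := by gcongr
    linarith

/-! ### The weight distribution and the strong law for the weights -/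

/-- The standing assumption on the weight distribution. -/
structure WeightLaw (ν : Measure ℝ) : Prop where
  prob : IsProbabilityMeasure ν
  pos : ∀ᵐ x ∂ν, 0 < x
  sup : IsLUB {x : ℝ | 0 < x ∧ ν (Set.Iic x) < 1} 1

lemma WeightLaw.ae_le_one {ν : Measure ℝ} (h : WeightLaw ν) : ∀ᵐ x ∂ν, x ≤ 1 := by
  have := h.prob
  have key : ∀ n : ℕ, ∀ᵐ x ∂ν, x ≤ 1 + 1 / ((n : ℝ) + 1) := fun n => by
    have hp : 0 < 1 / ((n : ℝ) + 1) := Nat.one_div_pos_of_nat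
    have : ν (Set.Iic (1 + 1 / ((n : ℝ) + 1))) = 1 := by
      by_contra hne
      have := h.sup.1 ⟨by linarith, lt_of_le_of_ne prob_le_one hne⟩
      linarith
    exact (mem_ae_iff_prob_eq_one measurableSet_Iic).2 this
  filter_upwards [ae_all_iff.2 key] with x hx
  refine ge_of_tendsto' (x := atTop) (b := x) (a := (1 : ℝ)) (f := fun n : ℕ => 1 + 1 / ((n : ℝ) + 1)) ?_ hx
  simpa using tendsto_one_div_add_atTop_nhds_zero_nat.const_add (1 : ℝ)

/-- Nearly maximal weights have positive frequency: some x > 1 - ε has ν (Iic x) < 1. The lower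
bound on the maximum in-degree rests on this. -/
lemma WeightLaw.measureReal_Ici_pos {ν : Measure ℝ} (h : WeightLaw ν) {ε : ℝ} (hε : 0 < ε) :
    0 < ν.real (Set.Ici (1 - ε)) := by
  have := h.prob
  obtain ⟨x, ⟨_, hx⟩, hlt, _⟩ := h.sup.exists_between (by linarith : 1 - ε < 1)
  have h1 : 0 < ν (Set.Ioi x) := by
    rw [← Set.compl_Iic, prob_compl_eq_one_sub measurableSet_Iic]
    exact tsub_pos_of_lt hx
  refine ENNReal.toReal_pos (h1.trans_le (measure_mono fun y hy => ?_)).ne' (measure_ne_top _ _)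
  exact hlt.le.trans (le_of_lt hy)

lemma WeightLaw.integrable {ν : Measure ℝ} (h : WeightLaw ν) : Integrable (fun x => x) ν := by
  have := h.prob
  refine Integrable.of_bound (C := 1) measurable_id.aestronglyMeasurable ?_
  filter_upwards [h.pos, h.ae_le_one] with x h0 h1
  rw [Real.norm_of_nonneg h0.le]; exact h1

lemma WeightLaw.mean_pos {ν : Measure ℝ} (h : WeightLaw ν) : 0 < ∫ x, x ∂ν := by
  have := h.prob
  rw [integral_pos_iff_support_of_nonneg_ae (h.pos.mono fun x hx => hx.le) h.integrable]
  have : ν (Function.support fun x : ℝ => x) = 1 := by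
    refine (mem_ae_iff_prob_eq_one (measurableSet_support (f := fun x : ℝ => x) measurable_id)).1 ?_
    exact h.pos.mono fun x hx => hx.ne'
  rw [this]; exact one_pos

lemma WeightLaw.mean_le_one {ν : Measure ℝ} (h : WeightLaw ν) : ∫ x, x ∂ν ≤ 1 := by
  have := h.prob
  have := integral_mono_ae h.integrable (integrable_const 1) h.ae_le_one
  simpa using this

lemma sum_Icc_one_eq_sum_range (f : ℕ → ℝ) (n : ℕ) :
    ∑ i ∈ Finset.Icc 1 n, f i = ∑ i ∈ Finset.range n, f (i + 1) := by
  rw [Finset.range_eq_Ico, Finset.sum_Ico_add' f 0 n 1]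
  rfl

variable [mΩ : MeasurableSpace Ω] {μ : Measure Ω} {ν : Measure ℝ} {m : ℕ}
  {W : ℕ → Ω → ℝ} {T : ℕ → Fin m → Ω → ℕ}

lemma IsWRG.weightLaw [IsProbabilityMeasure μ] (h : IsWRG μ ν m W T) (hpos : ∀ᵐ x ∂ν, 0 < x)
    (hsup : IsLUB {x : ℝ | 0 < x ∧ ν (Set.Iic x) < 1} 1) : WeightLaw ν := by
  refine ⟨?_, hpos, hsup⟩
  rw [← h.weight_law 1 le_rfl]
  exact Measure.isProbabilityMeasure_map (h.measurable_weight 1 le_rfl).aemeasurable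

lemma IsWRG.strong_law (h : IsWRG μ ν m W T) {g : ℝ → ℝ} (hg : Measurable g)
    (hi : Integrable g ν) :
    ∀ᵐ ω ∂μ, Tendsto (fun n : ℕ => (∑ i ∈ Finset.Icc 1 n, g (W i ω)) / n) atTop
      (𝓝 (∫ x, g x ∂ν)) := by
  have hW : ∀ i, Measurable (W (i + 1)) := fun i => h.measurable_weight _ (by omega)
  have hlaw : ∀ i, μ.map (W (i + 1)) = ν := fun i => h.weight_law _ (by omega)
  have := strong_law_ae_real (μ := μ) (fun i ω => g (W (i + 1) ω)) ?_ ?_ ?_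
  · have e : μ[fun ω => g (W (0 + 1) ω)] = ∫ x, g x ∂ν := by
      rw [← hlaw 0, integral_map (hW 0).aemeasurable hg.aestronglyMeasurable]
    rw [e] at this
    simpa only [sum_Icc_one_eq_sum_range] using this
  · rw [← hlaw 0] at hi
    exact hi.comp_measurable (hW 0)
  · exact fun i j hij => (h.weight_indep.indepFun hij).comp hg hg
  · intro i
    have : IdentDistrib (W (i + 1)) (W (0 + 1)) μ μ :=
      ⟨(hW i).aemeasurable, (hW 0).aemeasurable, by rw [hlaw, hlaw]⟩
    exact this.comp hg

lemma IsWRG.ae_exists_goodWeights [IsProbabilityMeasure μ] (h : IsWRG μ ν m W T)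
    (hν : WeightLaw ν) {ε : ℝ} (hε : 0 < ε) :
    ∀ᵐ ω ∂μ, ∃ K, GoodWeights W (∫ x, x ∂ν) ε K ω := by
  have := hν.prob
  have hind : Measurable ((Set.Ici (1 - ε)).indicator (1 : ℝ → ℝ)) :=
    measurable_one.indicator measurableSet_Ici
  filter_upwards [h.ae_weight hν.pos, h.ae_weight hν.ae_le_one,
    h.strong_law measurable_id hν.integrable,
    h.strong_law hind ((integrable_const 1).indicator measurableSet_Ici)] with ω h1 h2 h3 h4
  rw [integral_indicator_one measurableSet_Ici] at h4
  exact exists_goodWeights hν.mean_pos hε (hν.measureReal_Ici_pos hε) h1 h2 h3 h4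

end WRG

namespace WRG
variable {Ω : Type*}

/-! ### The upper bound on the in-degrees -/

variable {m : ℕ} {W : ℕ → Ω → ℝ} {T : ℕ → Fin m → Ω → ℕ}

/-- Every vertex is treated as if it had the maximal weight 1. -/
lemma GoodWeights.mean_le {c ε : ℝ} {K : ℕ} {ω : Ω} (h : GoodWeights W c ε K ω)
    {i N n : ℕ} (hi : 1 ≤ i) (hN : 1 ≤ N) (hn : N ≤ n) :
    ∑ j ∈ Finset.range (n - N), W i ω / totalWeight W (N + j) ω ≤
      (c⁻¹ + ε) * Real.log (n / N) + K := by
  refine le_trans ?_ (h.sum_le N n hN hn)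
  rw [Finset.sum_Ico_eq_sum_range]
  refine Finset.sum_le_sum fun j _ => ?_
  rw [div_eq_mul_inv]
  have := inv_pos.2 (totalWeight_pos (hN.trans (Nat.le_add_right N j)) h.pos)
  nlinarith [h.le_one i hi]

lemma GoodWeights.evolve_geom_le {c ε : ℝ} {K : ℕ} {ω : Ω} (h : GoodWeights W c ε K ω)
    {i n : ℕ} (hi : 1 ≤ i) (hn : i ≤ n) {t : ℝ} (ht : 1 ≤ t) :
    evolve m (fun j => W i ω / totalWeight W j ω) i (n - i) (fun k => t ^ k) 0 ≤
      Real.exp ((t - 1) * (m * K)) * (n / i : ℝ) ^ ((t - 1) * (m * (c⁻¹ + ε))) := by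
  have hi0 : (0 : ℝ) < i := by exact_mod_cast hi
  have hn0 : (0 : ℝ) < n := by exact_mod_cast hi.trans hn
  refine (WRG.evolve_geom_le (fun j hj =>
    div_totalWeight_mem (Finset.mem_Icc.2 ⟨hi, hj⟩) h.pos) _ (by linarith)).trans ?_
  rw [Real.rpow_def_of_pos (by positivity), ← Real.exp_add, Real.exp_le_exp]
  have h1 := h.mean_le hi hi hn
  have h2 := mul_le_mul_of_nonneg_left h1 (by
    have : 0 ≤ t - 1 := by linarith
    positivity : 0 ≤ (t - 1) * (m : ℝ))
  linarith

lemma sum_Icc_inv_two_pow_le (k : ℕ) : ∑ i ∈ Finset.Icc (1 : ℕ) (2 ^ k), (i : ℝ)⁻¹ ≤ k + 2 := by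
  have h1 := sum_inv_le_log_div_add_one (N := 1) (n := 2 ^ k + 1) le_rfl (Nat.le_add_left _ _)
  have h2 : Real.log (((2 ^ k + 1 : ℕ) : ℝ) / (1 : ℕ)) ≤ k + 1 := by
    have : (((2 ^ k + 1 : ℕ) : ℝ) / (1 : ℕ)) ≤ 2 ^ (k + 1) := by
      push_cast; rw [pow_succ]; linarith [one_le_pow₀ (M₀ := ℝ) one_le_two (n := k)]
    refine (Real.log_le_log (by positivity) this).trans ?_
    rw [Real.log_pow]
    have := Real.log_two_lt_d9
    push_cast
    nlinarith [Nat.cast_nonneg (α := ℝ) k]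
  change ∑ i ∈ Finset.Ico (1 : ℕ) (2 ^ k + 1), (i : ℝ)⁻¹ ≤ k + 2
  linarith

variable [mΩ : MeasurableSpace Ω] {μ : Measure Ω} {ν : Measure ℝ}

/-- The product bound for the single vertex i, started at time i, when its in-degree is still zero.
-/
lemma IsWRG.lintegral_geom_inDegree_le [IsProbabilityMeasure μ] (h : IsWRG μ ν m W T)
    (hν : WeightLaw ν) {c ε : ℝ} {K i n : ℕ} (hi : 1 ≤ i) (hn : i ≤ n) {t : ℝ} (ht : 1 ≤ t) :
    ∫⁻ ω in {ω | GoodWeights W c ε K ω}, ENNReal.ofReal (t ^ inDegree T n i ω) ∂μ ≤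
      ENNReal.ofReal (Real.exp ((t - 1) * (m * K)) *
        (n / i : ℝ) ^ ((t - 1) * (m * (c⁻¹ + ε)))) := by
  have hA := measurableSet_goodWeights W c ε K
  have hpos := h.ae_weight hν.pos
  have key := h.lintegral_evolve_le hpos hi (n - i) (B := {i})
    (by simpa using hi) hA (fun ω hω => hω.pos) (F := fun _ _ k => t ^ k)
    (fun _ _ _ => measurable_const) (fun _ _ _ _ k => pow_nonneg (by linarith) k)
    (fun _ _ => Or.inl fun _ _ => pow_right_mono₀ ht)
  simp only [Finset.prod_singleton, Nat.add_sub_cancel' hn] at key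
  refine key.trans ?_
  calc _ ≤ ∫⁻ ω in {ω | GoodWeights W c ε K ω}, ENNReal.ofReal (Real.exp ((t - 1) * (m * K)) *
        (n / i : ℝ) ^ ((t - 1) * (m * (c⁻¹ + ε)))) ∂μ := by
        refine setLIntegral_mono_ae measurable_const.aemeasurable ?_
        filter_upwards [h.ae_inDegree_self hpos] with ω h0 hω
        rw [h0 i]
        exact ENNReal.ofReal_le_ofReal (hω.evolve_geom_le hi hn ht)
    _ ≤ _ := by
        rw [setLIntegral_const]
        exact mul_le_of_le_one_right' prob_le_one

/-- Uniform upper bound on the in-degrees along powers of two, on the event of good weights. -/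
lemma IsWRG.ae_geom_inDegree_le_aux [IsProbabilityMeasure μ] (h : IsWRG μ ν m W T)
    (hν : WeightLaw ν) {c ε κ α t : ℝ} (hκ : 0 < κ) (ht : 1 ≤ t)
    (hα : α = (t - 1) * (m * (c⁻¹ + ε))) (K : ℕ) :
    ∀ᵐ ω ∂μ, GoodWeights W c ε K ω → ∃ C, 0 < C ∧ ∀ k : ℕ, ∀ i ∈ Finset.Icc (1 : ℕ) (2 ^ k),
      (i : ℝ) ^ (α - 1) * ((2 : ℝ) ^ k) ^ (-(α + κ)) * t ^ inDegree T (2 ^ k) i ω ≤ C := by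
  set A := {ω | GoodWeights W c ε K ω} with hAdef
  have hA : MeasurableSet A := h.weightAlgebra_le _ (measurableSet_goodWeights W c ε K)
  set D := Real.exp ((t - 1) * (m * K)) with hD
  have hmeas : ∀ n i, Measurable fun ω => ENNReal.ofReal (t ^ inDegree T n i ω) := fun n i =>
    ENNReal.measurable_ofReal.comp
      (measurable_const.pow ((measurable_inDegree W T n i).mono (h.history_le n) le_rfl))
  have hterm : ∀ k i : ℕ, Measurable fun ω =>
      ENNReal.ofReal ((i : ℝ) ^ (α - 1) * ((2 : ℝ) ^ k) ^ (-(α + κ))) *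
        ENNReal.ofReal (t ^ inDegree T (2 ^ k) i ω) := fun k i => (hmeas _ _).const_mul _
  -- The factor i^(α-1) turns the moment bound (2^k / i)^α into 1/i, so level k has expectation at
  -- most D 2^(-κk) (k+2) on A. Thus V is almost surely finite there and bounds every single term.
  set V : Ω → ENNReal := fun ω => ∑' k : ℕ, ∑ i ∈ Finset.Icc (1 : ℕ) (2 ^ k),
    ENNReal.ofReal ((i : ℝ) ^ (α - 1) * ((2 : ℝ) ^ k) ^ (-(α + κ))) *
      ENNReal.ofReal (t ^ inDegree T (2 ^ k) i ω) with hV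
  have hVm : Measurable V := Measurable.tsum fun k =>
    Finset.measurable_sum _ fun i _ => hterm k i
  have hr0 : (0 : ℝ) < 2 ^ (-κ) := by positivity
  have hr1 : (2 : ℝ) ^ (-κ) < 1 := Real.rpow_lt_one_of_one_lt_of_neg one_lt_two (by linarith)
  have hsum : Summable fun k : ℕ => D * ((2 : ℝ) ^ (-κ)) ^ k * (k + 2) := by
    have s1 := (summable_pow_mul_geometric_of_norm_lt_one 1 (r := (2 : ℝ) ^ (-κ))
      (by rwa [Real.norm_of_nonneg hr0.le])).mul_left D
    have s2 := (summable_geometric_of_lt_one hr0.le hr1).mul_left (2 * D)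
    refine (s1.add s2).congr fun k => ?_
    ring
  have hfin : ∫⁻ ω in A, V ω ∂μ ≠ ⊤ := by
    have hle : ∫⁻ ω in A, V ω ∂μ ≤
        ∑' k : ℕ, ENNReal.ofReal (D * ((2 : ℝ) ^ (-κ)) ^ k * (k + 2)) := by
      rw [hV, lintegral_tsum fun k =>
        (Finset.measurable_sum _ fun i _ => hterm k i).aemeasurable]
      refine ENNReal.tsum_le_tsum fun k => ?_
      rw [lintegral_finsetSum _ fun i _ => hterm k i]
      calc _ ≤ ∑ i ∈ Finset.Icc (1 : ℕ) (2 ^ k),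
            ENNReal.ofReal (D * ((2 : ℝ) ^ (-κ)) ^ k * (i : ℝ)⁻¹) := by
            refine Finset.sum_le_sum fun i hi => ?_
            obtain ⟨hi1, hi2⟩ := Finset.mem_Icc.1 hi
            have hi0 : (0 : ℝ) < i := by exact_mod_cast hi1
            rw [lintegral_const_mul _ (hmeas _ _)]
            refine (mul_le_mul_right (h.lintegral_geom_inDegree_le hν hi1 hi2 ht) _).trans ?_
            rw [← ENNReal.ofReal_mul (by positivity), ← hα, ← hD]
            refine ENNReal.ofReal_le_ofReal (le_of_eq ?_)
            have h2k : (0 : ℝ) < 2 ^ k := by positivity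
            push_cast
            rw [Real.div_rpow h2k.le hi0.le, Real.rpow_sub_one hi0.ne', neg_add,
              Real.rpow_add h2k, Real.rpow_neg h2k.le α, ← Real.rpow_natCast (2 ^ (-κ)) k,
              ← Real.rpow_mul zero_le_two, mul_comm (-κ), Real.rpow_mul zero_le_two,
              Real.rpow_natCast]
            have h3 : (0 : ℝ) < ((2 : ℝ) ^ k) ^ α := by positivity
            have h4 : (0 : ℝ) < (i : ℝ) ^ α := by positivity
            field_simp
        _ = ENNReal.ofReal (D * ((2 : ℝ) ^ (-κ)) ^ k * ∑ i ∈ Finset.Icc (1 : ℕ) (2 ^ k), (i : ℝ)⁻¹) := by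
            rw [Finset.mul_sum, ENNReal.ofReal_sum_of_nonneg]
            exact fun i _ => by positivity
        _ ≤ _ := by
            refine ENNReal.ofReal_le_ofReal ?_
            gcongr
            exact sum_Icc_inv_two_pow_le k
    refine (hle.trans_lt ?_).ne
    rw [← ENNReal.ofReal_tsum_of_nonneg (fun k => by positivity) hsum]
    exact ENNReal.ofReal_lt_top
  have hae := ae_lt_top hVm hfin
  rw [ae_restrict_iff' hA] at hae
  filter_upwards [hae] with ω hω hgood
  have hlt := hω hgood
  refine ⟨(V ω).toReal + 1, by positivity, fun k i hi => ?_⟩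
  have h1 : ENNReal.ofReal ((i : ℝ) ^ (α - 1) * ((2 : ℝ) ^ k) ^ (-(α + κ))) *
      ENNReal.ofReal (t ^ inDegree T (2 ^ k) i ω) ≤ V ω :=
    (Finset.single_le_sum (f := fun i : ℕ => ENNReal.ofReal ((i : ℝ) ^ (α - 1) *
      ((2 : ℝ) ^ k) ^ (-(α + κ))) * ENNReal.ofReal (t ^ inDegree T (2 ^ k) i ω))
      (fun _ _ => zero_le) hi).trans (ENNReal.le_tsum k)
  rw [← ENNReal.ofReal_mul (by positivity), ENNReal.ofReal_le_iff_le_toReal hlt.ne] at h1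
  linarith

/-- Almost sure upper bound on the in-degrees, uniformly over the vertices. -/
lemma IsWRG.ae_inDegree_le [IsProbabilityMeasure μ] (h : IsWRG μ ν m W T)
    (hν : WeightLaw ν) {ε κ α t : ℝ} (hε : 0 < ε) (hκ : 0 < κ) (ht : 1 < t)
    (hα : α = (t - 1) * (m * ((∫ x, x ∂ν)⁻¹ + ε))) :
    ∀ᵐ ω ∂μ, ∃ C, ∀ n : ℕ, ∀ i ∈ Finset.Icc 1 n, inDegree T n i ω * Real.log t ≤
      (1 - α) * Real.log i + (α + κ) * Real.log n + C := by
  filter_upwards [h.ae_exists_goodWeights hν hε,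
    ae_all_iff.2 fun K => h.ae_geom_inDegree_le_aux hν hκ ht.le hα K] with ω ⟨K, hK⟩ hω
  obtain ⟨C, hC0, hC⟩ := hω K hK
  have hα0 : 0 ≤ α := by
    have := inv_pos.2 hν.mean_pos
    have : 0 ≤ t - 1 := by linarith
    rw [hα]; positivity
  have hlt : 0 < Real.log t := Real.log_pos ht
  refine ⟨Real.log C + (α + κ) * Real.log 2, fun n i hi => ?_⟩
  obtain ⟨hi1, hi2⟩ := Finset.mem_Icc.1 hi
  have hn1 := hi1.trans hi2
  have hi0 : (0 : ℝ) < i := by exact_mod_cast hi1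
  have hn0 : (0 : ℝ) < n := by exact_mod_cast hn1
  -- In-degrees grow with n, so n may be replaced by the next power of two, at the cost of log 2 in
  -- log n.
  have hnk := Nat.lt_pow_succ_log_self one_lt_two n
  have hkn := Nat.pow_log_le_self 2 (by omega : n ≠ 0)
  set k := Nat.log 2 n + 1 with hk
  have h1 := hC k i (Finset.mem_Icc.2 ⟨hi1, hi2.trans hnk.le⟩)
  have h2 := Real.log_le_log (by positivity) h1
  rw [Real.log_mul (by positivity) (by positivity), Real.log_mul (by positivity) (by positivity),
    Real.log_rpow hi0, Real.log_rpow (by positivity), Real.log_pow t] at h2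
  have h3 : Real.log ((2 : ℝ) ^ k) ≤ Real.log n + Real.log 2 := by
    rw [← Real.log_mul hn0.ne' two_ne_zero]
    refine Real.log_le_log (by positivity) ?_
    rw [hk, pow_succ]
    have : ((2 ^ Nat.log 2 n : ℕ) : ℝ) ≤ n := by exact_mod_cast hkn
    push_cast at this
    linarith
  have h4 : (inDegree T n i ω : ℝ) ≤ inDegree T (2 ^ k) i ω := by
    exact_mod_cast inDegree_mono T hnk.le i ω
  have h5 := mul_le_mul_of_nonneg_right h4 hlt.le
  have h6 := mul_le_mul_of_nonneg_left h3 (by linarith : 0 ≤ α + κ)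
  linarith

end WRG

namespace WRG
variable {Ω : Type*}

/-! ### The lower bound on the maximum in-degree -/

/-- Cramér's lower bound, in terms of moment generating functions. Here `P` plays the role of the
mean of a sum of Bernoulli variables, and `X`, `Y₁`, `Y₂` are the values of its moment generating
function at `θ`, `θ * s` and `θ / s`. -/
lemma exists_tilt {θ y ρ : ℝ} (hθ : 1 < θ) (hy : 0 < y) (hρ : 0 < ρ) (C : ℝ) :
    ∃ s > 1, ∃ L₀, ∀ L, L₀ ≤ L → ∀ P X Y₁ Y₂ : ℝ, 0 ≤ P → |θ * P - y * L| ≤ ρ / 4 * L →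
      Real.exp ((θ - 1) * P - C) ≤ X → Y₁ ≤ Real.exp ((θ * s - 1) * P) →
      Y₂ ≤ Real.exp ((θ / s - 1) * P) →
      Real.exp (-C) / 2 * Real.exp (-((y + ρ) * Real.log θ - (θ - 1) / θ * (y - ρ / 4)) * L) ≤
        θ ^ (-((y + ρ) * L)) * (X - s ^ (-((y + ρ) * L)) * Y₁ - s ^ ((y - ρ) * L) * Y₂) := by
  have hyρ : 0 < y + ρ / 4 := by positivity
  -- With s = exp v, the linear part of each correction exponent is at most -(3ρ/4) v L, and the
  -- quadratic part at most v² (y + ρ/4) L ≤ (ρ/2) v L; -(ρ/4) v L remains.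
  obtain ⟨v, hv0, hv1, hv⟩ : ∃ v, 0 < v ∧ v ≤ 1 ∧ v * (y + ρ / 4) ≤ ρ / 2 := by
    refine ⟨min 1 (ρ / 2 / (y + ρ / 4)), by positivity, min_le_left _ _, ?_⟩
    rw [← le_div_iff₀ hyρ]; exact min_le_right _ _
  have hη : 0 < ρ * v / 4 := by positivity
  -- For such L each of the two corrections is at most a quarter of exp ((θ-1) P - C), so half of it
  -- survives.
  refine ⟨Real.exp v, by simpa using hv0, max 0 ((C + Real.log 4) / (ρ * v / 4)), ?_⟩
  intro L hL P X Y₁ Y₂ hP hPL hX hY₁ hY₂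
  have hL0 : 0 ≤ L := (le_max_left _ _).trans hL
  have hL1 : C + Real.log 4 ≤ ρ * v / 4 * L := by
    have := (le_max_right _ _).trans hL
    rwa [div_le_iff₀ hη, mul_comm] at this
  obtain ⟨hlo, hhi⟩ := abs_le.1 hPL
  have hθP : 0 ≤ θ * P := by positivity
  have hevp : Real.exp v ≤ 1 + v + v ^ 2 := by
    have := (abs_le.1 (Real.abs_exp_sub_one_sub_id_le (x := v) (by rwa [abs_of_pos hv0]))).2
    linarith
  have hevn : Real.exp (-v) ≤ 1 - v + v ^ 2 := by
    have := (abs_le.1 (Real.abs_exp_sub_one_sub_id_le (x := -v)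
      (by rwa [abs_neg, abs_of_pos hv0]))).2
    nlinarith
  have hsmall : Real.exp (-(ρ * v / 4 * L)) ≤ Real.exp (-C) / 4 := by
    calc Real.exp (-(ρ * v / 4 * L)) ≤ Real.exp (-C - Real.log 4) :=
          Real.exp_le_exp.2 (by linarith)
      _ = Real.exp (-C) / 4 := by rw [Real.exp_sub, Real.exp_log (by norm_num)]
  have h1 : Real.exp v ^ (-((y + ρ) * L)) * Y₁ ≤
      Real.exp ((θ - 1) * P) * (Real.exp (-C) / 4) := by
    calc _ ≤ Real.exp v ^ (-((y + ρ) * L)) * Real.exp ((θ * Real.exp v - 1) * P) := by gcongr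
      _ = Real.exp ((θ - 1) * P) *
          Real.exp ((Real.exp v - 1) * (θ * P) - v * ((y + ρ) * L)) := by
          rw [← Real.exp_mul, ← Real.exp_add, ← Real.exp_add]; congr 1; ring
      _ ≤ Real.exp ((θ - 1) * P) * Real.exp (-(ρ * v / 4 * L)) := by
          gcongr
          have a1 : (Real.exp v - 1) * (θ * P) ≤ (v + v ^ 2) * (θ * P) := by gcongr; linarith
          have a2 : (v + v ^ 2) * (θ * P) ≤ (v + v ^ 2) * ((y + ρ / 4) * L) :=
            mul_le_mul_of_nonneg_left (by linarith) (by positivity)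
          have a3 : v * L * (v * (y + ρ / 4)) ≤ v * L * (ρ / 2) := by gcongr
          nlinarith
      _ ≤ _ := by gcongr
  have h2 : Real.exp v ^ ((y - ρ) * L) * Y₂ ≤
      Real.exp ((θ - 1) * P) * (Real.exp (-C) / 4) := by
    calc _ ≤ Real.exp v ^ ((y - ρ) * L) * Real.exp ((θ / Real.exp v - 1) * P) := by gcongr
      _ = Real.exp ((θ - 1) * P) *
          Real.exp ((Real.exp (-v) - 1) * (θ * P) + v * ((y - ρ) * L)) := by
          rw [← Real.exp_mul, ← Real.exp_add, ← Real.exp_add, Real.exp_neg]; congr 1; ring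
      _ ≤ Real.exp ((θ - 1) * P) * Real.exp (-(ρ * v / 4 * L)) := by
          gcongr
          have a1 : (Real.exp (-v) - 1) * (θ * P) ≤ (-v + v ^ 2) * (θ * P) := by gcongr; linarith
          have a2 : (v - v ^ 2) * ((y - ρ / 4) * L) ≤ (v - v ^ 2) * (θ * P) :=
            mul_le_mul_of_nonneg_left (by linarith) (by nlinarith)
          have a3 : v * L * (v * (y + ρ / 4)) ≤ v * L * (ρ / 2) := by gcongr
          have a4 : 0 ≤ v * L * (v * (ρ / 2)) := by positivity
          nlinarith
      _ ≤ _ := by gcongr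
  have h3 : Real.exp ((θ - 1) * P) * (Real.exp (-C) / 2) ≤
      X - Real.exp v ^ (-((y + ρ) * L)) * Y₁ - Real.exp v ^ ((y - ρ) * L) * Y₂ := by
    rw [sub_eq_add_neg, Real.exp_add] at hX
    linarith
  have h4 : (θ - 1) / θ * (y - ρ / 4) * L ≤ (θ - 1) * P := by
    have : (θ - 1) * P = (θ - 1) / θ * (θ * P) := by field_simp
    rw [this, mul_assoc]
    exact mul_le_mul_of_nonneg_left (by linarith) (div_nonneg (by linarith) (by linarith))
  calc _ = Real.exp (-((y + ρ) * L * Real.log θ)) *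
        (Real.exp ((θ - 1) / θ * (y - ρ / 4) * L) * (Real.exp (-C) / 2)) := by
        rw [← mul_assoc, ← Real.exp_add, mul_comm]; congr 2; ring
    _ ≤ Real.exp (-((y + ρ) * L * Real.log θ)) *
        (Real.exp ((θ - 1) * P) * (Real.exp (-C) / 2)) := by gcongr
    _ = θ ^ (-((y + ρ) * L)) * (Real.exp ((θ - 1) * P) * (Real.exp (-C) / 2)) := by
        rw [Real.rpow_def_of_pos (by linarith : 0 < θ)]; congr 2; ring
    _ ≤ _ := by
        have : 0 < θ ^ (-((y + ρ) * L)) := Real.rpow_pos_of_pos (by linarith) _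
        gcongr

variable {m : ℕ} {W : ℕ → Ω → ℝ} {T : ℕ → Fin m → Ω → ℕ}

lemma GoodWeights.K_pos {c ε : ℝ} {K : ℕ} {ω : Ω} (h : GoodWeights W c ε K ω) : 0 < K := by
  rcases Nat.eq_zero_or_pos K with rfl | hK
  · have := h.le_count 1 (Nat.zero_le _)
    norm_num at this
  · exact hK

/-- The coefficient is (1-ε)(c⁻¹-ε) without its ε² term. -/
lemma GoodWeights.le_mean {c ε : ℝ} {K : ℕ} {ω : Ω} (h : GoodWeights W c ε K ω) (hε : 0 < ε)
    (hε1 : ε ≤ 1) {i N n : ℕ} (hi : 1 - ε ≤ W i ω) (hN : 1 ≤ N) (hn : N ≤ n) :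
    (c⁻¹ - ε * (1 + c⁻¹)) * Real.log (n / N) - K ≤
      ∑ j ∈ Finset.range (n - N), W i ω / totalWeight W (N + j) ω := by
  have h0 : 0 ≤ Real.log (n / N) := Real.log_nonneg (by
    rw [one_le_div (by positivity)]; exact_mod_cast hn)
  have h1 := h.le_sum N n hN hn
  rw [Finset.sum_Ico_eq_sum_range] at h1
  have h2 : (1 - ε) * ∑ j ∈ Finset.range (n - N), (totalWeight W (N + j) ω)⁻¹ ≤
      ∑ j ∈ Finset.range (n - N), W i ω / totalWeight W (N + j) ω := by
    rw [Finset.mul_sum]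
    refine Finset.sum_le_sum fun j _ => ?_
    have := inv_pos.2 (totalWeight_pos (hN.trans (Nat.le_add_right N j)) h.pos)
    rw [div_eq_mul_inv]
    gcongr
  have h3 := mul_le_mul_of_nonneg_left h1 (by linarith : 0 ≤ 1 - ε)
  have h4 : 0 ≤ ε ^ 2 * Real.log (n / N) := by positivity
  have h5 : 0 ≤ ε * K := by positivity
  nlinarith

lemma GoodWeights.sum_sq_mean_le {c ε : ℝ} {K : ℕ} {ω : Ω} (h : GoodWeights W c ε K ω)
    {i N n : ℕ} (hi : 1 ≤ i) (hN : 1 ≤ N) :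
    ∑ j ∈ Finset.range (n - N), (W i ω / totalWeight W (N + j) ω) ^ 2 ≤ K := by
  have h1 : ∑ l ∈ Finset.Ico N n, (totalWeight W l ω)⁻¹ ^ 2 ≤ K :=
    (Finset.sum_le_sum_of_subset_of_nonneg (Finset.Ico_subset_Ico_left hN)
      fun _ _ _ => sq_nonneg _).trans (h.sum_sq_le n)
  refine le_trans ?_ h1
  rw [Finset.sum_Ico_eq_sum_range]
  refine Finset.sum_le_sum fun j _ => ?_
  have hS := inv_pos.2 (totalWeight_pos (hN.trans (Nat.le_add_right N j)) h.pos)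
  have hW := h.pos i hi
  rw [div_eq_mul_inv]
  refine pow_le_pow_left₀ (by positivity) ?_ 2
  nlinarith [h.le_one i hi]

lemma floor_rpow_le {γ : ℝ} (hγ : γ ≤ 1) {n : ℕ} (hn : 1 ≤ n) : ⌊(n : ℝ) ^ γ⌋₊ ≤ n := by
  refine Nat.floor_le_of_le ?_
  calc (n : ℝ) ^ γ ≤ (n : ℝ) ^ (1 : ℝ) :=
        Real.rpow_le_rpow_of_exponent_le (by exact_mod_cast hn) hγ
    _ = n := Real.rpow_one _

lemma half_rpow_le_floor {γ : ℝ} (hγ : 0 ≤ γ) {n : ℕ} (hn : 1 ≤ n) :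
    (n : ℝ) ^ γ / 2 ≤ ⌊(n : ℝ) ^ γ⌋₊ := by
  have h1 : 1 ≤ (n : ℝ) ^ γ := Real.one_le_rpow (by exact_mod_cast hn) hγ
  have h2 := Nat.lt_floor_add_one ((n : ℝ) ^ γ)
  have h3 : (1 : ℝ) ≤ ⌊(n : ℝ) ^ γ⌋₊ := by
    exact_mod_cast (Nat.one_le_floor_iff _).2 h1
  linarith

lemma log_div_floor_rpow_mem {γ : ℝ} (hγ : 0 ≤ γ) {n : ℕ} (hn : 1 ≤ n) :
    (1 - γ) * Real.log n ≤ Real.log (n / ⌊(n : ℝ) ^ γ⌋₊) ∧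
      Real.log (n / ⌊(n : ℝ) ^ γ⌋₊) ≤ (1 - γ) * Real.log n + 1 := by
  have hn0 : (0 : ℝ) < n := by exact_mod_cast hn
  have hp : (0 : ℝ) < (n : ℝ) ^ γ := by positivity
  have h1 := half_rpow_le_floor hγ hn
  have h2 := Nat.floor_le hp.le
  have hN : (0 : ℝ) < ⌊(n : ℝ) ^ γ⌋₊ := by linarith
  rw [Real.log_div hn0.ne' hN.ne']
  have h3 := Real.log_le_log hN h2
  have h4 := Real.log_le_log (by positivity) h1
  rw [Real.log_rpow hn0] at h3
  rw [Real.log_div hp.ne' two_ne_zero, Real.log_rpow hn0] at h4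
  have := Real.log_two_lt_d9
  constructor <;> linarith

/-- The probability that an early vertex of nearly maximal weight has a large in-degree. -/
lemma exists_evolve_tail_le {c ε θ γ ρ : ℝ} (hm : 1 ≤ m) (hc : 0 < c) (hθ : θ = 1 + c / m)
    (hγ0 : 0 ≤ γ) (hγ1 : γ < 1) (hρ : 0 < ρ) (hε : 0 < ε) (hε1 : ε ≤ 1)
    (hερ : θ * (m * (ε * (1 + c⁻¹))) ≤ ρ / 8) (K : ℕ) {y : ℝ} (hy : y = θ * (1 - γ) / (θ - 1)) :
    ∃ D > 0, ∀ᶠ n : ℕ in atTop, ∀ ω : Ω, GoodWeights W c ε K ω →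
      ∀ i ∈ Finset.Icc 1 ⌊(n : ℝ) ^ γ⌋₊, 1 - ε ≤ W i ω →
      evolve m (fun j => W i ω / totalWeight W j ω) ⌊(n : ℝ) ^ γ⌋₊ (n - ⌊(n : ℝ) ^ γ⌋₊)
        (fun k => if (k : ℝ) < (y - ρ) * Real.log n then 1 else 0) 0 ≤
      1 - D * (n : ℝ) ^ (-((y + ρ) * Real.log θ - (θ - 1) / θ * (y - ρ / 4))) := by
  have hm0 : (0 : ℝ) < m := by exact_mod_cast hm
  have hcm : 0 < c / m := by positivity
  have hθ1 : 1 < θ := by linarith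
  have hθ0 : 0 < θ := by linarith
  have hy0 : 0 < y := by
    rw [hy]; exact div_pos (mul_pos hθ0 (by linarith)) (by linarith)
  -- The mean number of edges gained is about m c⁻¹ (1-γ) log n, and tilting by θ multiplies it by
  -- θ: y log n is the tilted mean.
  have hy' : y = θ * (m * (c⁻¹ * (1 - γ))) := by
    rw [hy, show θ - 1 = c / m by linarith]; field_simp
  obtain ⟨s, hs, L₀, hL₀⟩ := exists_tilt hθ1 hy0 hρ ((θ - 1) ^ 2 * (m * K))
  refine ⟨Real.exp (-((θ - 1) ^ 2 * (m * K))) / 2, by positivity, ?_⟩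
  have hlog : Tendsto (fun n : ℕ => Real.log n) atTop atTop :=
    Real.tendsto_log_atTop.comp tendsto_natCast_atTop_atTop
  -- The tolerance ρ/4 of `exists_tilt` is split into ρ/8 for the ε-errors and ρ/8 for the bounded
  -- ones, absorbed by large n.
  filter_upwards [eventually_ge_atTop 1, hlog.eventually_ge_atTop L₀,
    hlog.eventually_ge_atTop (8 / ρ * (θ * (m * (c⁻¹ + ε + K))))] with n hn hnL hnK ω hω i hi hiW
  have hn0 : (0 : ℝ) < n := by exact_mod_cast hn
  obtain ⟨hi1, hiN⟩ := Finset.mem_Icc.1 hi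
  have hN1 := hi1.trans hiN
  have hNn := floor_rpow_le hγ1.le hn
  obtain ⟨hl1, hl2⟩ := log_div_floor_rpow_mem hγ0 hn
  set N := ⌊(n : ℝ) ^ γ⌋₊ with hN
  set L := Real.log n with hL
  have hp : ∀ j, N ≤ j → 0 ≤ W i ω / totalWeight W j ω ∧ W i ω / totalWeight W j ω ≤ 1 :=
    fun j hj => div_totalWeight_mem (Finset.mem_Icc.2 ⟨hi1, hiN.trans hj⟩) hω.pos
  have hS1 := hω.mean_le hi1 hN1 hNn
  have hS2 := hω.le_mean hε hε1 hiW hN1 hNn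
  have hS3 := hω.sum_sq_mean_le (n := n) hi1 hN1
  set R := ∑ j ∈ Finset.range (n - N), W i ω / totalWeight W (N + j) ω with hR
  have hR0 : 0 ≤ R := Finset.sum_nonneg fun j _ => (hp _ (Nat.le_add_right _ _)).1
  have hL0 : 0 ≤ L := Real.log_nonneg (by exact_mod_cast hn)
  have hci : 0 < c⁻¹ := inv_pos.2 hc
  have hKL : θ * (m * (c⁻¹ + ε + K)) ≤ ρ / 8 * L := by
    have : ρ / 8 * (8 / ρ * (θ * (m * (c⁻¹ + ε + K)))) ≤ ρ / 8 * L := by gcongr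
    have e : ρ / 8 * (8 / ρ * (θ * (m * (c⁻¹ + ε + K)))) = θ * (m * (c⁻¹ + ε + K)) := by
      field_simp
    linarith
  have hεL : θ * (m * (ε * (1 + c⁻¹))) * ((1 - γ) * L) ≤ ρ / 8 * L := by
    have h1 : (1 - γ) * L ≤ L := by nlinarith
    have h2 : 0 ≤ (1 - γ) * L := mul_nonneg (by linarith) hL0
    calc _ ≤ ρ / 8 * ((1 - γ) * L) := by gcongr
      _ ≤ ρ / 8 * L := by gcongr
  have hγL : 0 ≤ (1 - γ) * L := mul_nonneg (by linarith) hL0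
  have hup : θ * (m * R) ≤ y * L + ρ / 4 * L := by
    have h1 : R ≤ (c⁻¹ + ε) * ((1 - γ) * L + 1) + K := hS1.trans (by gcongr)
    have h2 : θ * (m * R) ≤ θ * (m * ((c⁻¹ + ε) * ((1 - γ) * L + 1) + K)) := by gcongr
    have h3 : 0 ≤ θ * (m * (ε * c⁻¹)) * ((1 - γ) * L) := by positivity
    rw [hy']
    linarith
  have hlow : y * L - ρ / 4 * L ≤ θ * (m * R) := by
    have h1 : c⁻¹ * ((1 - γ) * L) - ε * (1 + c⁻¹) * ((1 - γ) * L + 1) - K ≤ R := by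
      refine le_trans ?_ hS2
      have a1 : c⁻¹ * ((1 - γ) * L) ≤ c⁻¹ * Real.log (n / N) := by gcongr
      have a2 : ε * (1 + c⁻¹) * Real.log (n / N) ≤ ε * (1 + c⁻¹) * ((1 - γ) * L + 1) := by gcongr
      linarith
    have h2 : θ * (m * (c⁻¹ * ((1 - γ) * L) - ε * (1 + c⁻¹) * ((1 - γ) * L + 1) - K)) ≤
      θ * (m * R) := by gcongr
    have h3 : 0 ≤ θ * (m * ((1 - ε) * c⁻¹)) :=
      mul_nonneg hθ0.le (mul_nonneg hm0.le (mul_nonneg (by linarith) hci.le))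
    rw [hy']
    linarith
  have hmain := hL₀ L hnL (m * R) (evolve m (fun j => W i ω / totalWeight W j ω) N (n - N)
    (fun k => θ ^ k) 0) (evolve m (fun j => W i ω / totalWeight W j ω) N (n - N)
    (fun k => (θ * s) ^ k) 0) (evolve m (fun j => W i ω / totalWeight W j ω) N (n - N)
    (fun k => (θ / s) ^ k) 0) (by positivity) (abs_le.2 ⟨by linarith, by linarith⟩) ?_
    (evolve_geom_le hp _ (by positivity)) (evolve_geom_le hp _ (by positivity))
  · have htail := evolve_tail_le (m := m) hp (n - N) (a := (y - ρ) * L) (b := (y + ρ) * L)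
      hθ1.le hs
    rw [Real.rpow_def_of_pos hn0, ← hL, mul_comm L]
    linarith
  · refine le_trans (Real.exp_le_exp.2 ?_) (le_evolve_geom hp _ hθ1.le)
    gcongr

variable [mΩ : MeasurableSpace Ω] {μ : Measure Ω} {ν : Measure ℝ}

lemma IsWRG.measurableSet_inDegree_lt (h : IsWRG μ ν m W T) (N n : ℕ) (a : ℝ) :
    MeasurableSet {ω | ∀ i ∈ Finset.Icc 1 N, (inDegree T n i ω : ℝ) < a} := by
  simp only [Set.ofPred_forall]
  refine .iInter fun i => .iInter fun _ => measurableSet_lt ?_ measurable_const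
  exact measurable_from_nat.comp ((measurable_inDegree W T n i).mono (h.history_le n) le_rfl)

/-- The probability that no early vertex has a large in-degree. -/
lemma IsWRG.measure_inDegree_lt_le [IsProbabilityMeasure μ] (h : IsWRG μ ν m W T)
    (hν : WeightLaw ν) {c ε q a : ℝ} {K N n : ℕ} (hN : 1 ≤ N) (hn : N ≤ n) (hKN : K ≤ N)
    (hq : 0 ≤ q) (hE : ∀ ω : Ω, GoodWeights W c ε K ω → ∀ i ∈ Finset.Icc 1 N, 1 - ε ≤ W i ω →
      evolve m (fun j => W i ω / totalWeight W j ω) N (n - N)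
        (fun k => if (k : ℝ) < a then 1 else 0) 0 ≤ 1 - q) :
    μ {ω | GoodWeights W c ε K ω ∧ ∀ i ∈ Finset.Icc 1 N, (inDegree T n i ω : ℝ) < a} ≤
      ENNReal.ofReal (Real.exp (-(q * (N / K)))) := by
  have hA := measurableSet_goodWeights W c ε K
  have hpos := h.ae_weight hν.pos
  have hf0 : (0 : ℕ → ℝ) ≤ fun k : ℕ => if (k : ℝ) < a then (1 : ℝ) else 0 := fun k => by
    simp only [Pi.zero_apply]; positivity
  have hf1 : (fun k : ℕ => if (k : ℝ) < a then (1 : ℝ) else 0) ≤ 1 := fun k => by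
    simp only [Pi.one_apply]; split_ifs <;> norm_num
  have hanti : Antitone fun k : ℕ => if (k : ℝ) < a then (1 : ℝ) else 0 := fun k l hkl => by
    have : (k : ℝ) ≤ l := by exact_mod_cast hkl
    simp only
    split_ifs <;> linarith
  have key := h.lintegral_evolve_le hpos hN (n - N) (B := Finset.Icc 1 N) subset_rfl hA
    (fun ω hω => hω.pos) (F := fun _ _ k => if (k : ℝ) < a then (1 : ℝ) else 0)
    (fun _ _ _ => measurable_const) (fun _ _ _ _ => hf0) (fun _ _ => Or.inr fun _ _ => hanti)
  rw [Nat.add_sub_cancel' hn] at key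
  set E := {ω | GoodWeights W c ε K ω ∧ ∀ i ∈ Finset.Icc 1 N, (inDegree T n i ω : ℝ) < a} with hEdef
  have hEm : MeasurableSet E :=
    (h.weightAlgebra_le _ hA).inter (h.measurableSet_inDegree_lt N n a)
  calc μ E = ∫⁻ _ in E, 1 ∂μ := by simp
    _ = ∫⁻ ω in E, ENNReal.ofReal (∏ i ∈ Finset.Icc 1 N,
          if (inDegree T n i ω : ℝ) < a then (1 : ℝ) else 0) ∂μ := by
        refine setLIntegral_congr_fun hEm fun ω hω => ?_
        rw [Finset.prod_congr rfl fun i hi => if_pos (hω.2 i hi)]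
        simp
    _ ≤ ∫⁻ ω in {ω | GoodWeights W c ε K ω}, ENNReal.ofReal (∏ i ∈ Finset.Icc 1 N,
          if (inDegree T n i ω : ℝ) < a then (1 : ℝ) else 0) ∂μ :=
        lintegral_mono_set fun ω hω => hω.1
    _ ≤ _ := key
    _ ≤ ∫⁻ ω in {ω | GoodWeights W c ε K ω},
          ENNReal.ofReal (Real.exp (-(q * (N / K)))) ∂μ := by
        refine setLIntegral_mono measurable_const fun ω hω => ENNReal.ofReal_le_ofReal ?_
        have hω' : GoodWeights W c ε K ω := hω
        have hK0 : (0 : ℝ) < K := by exact_mod_cast hω'.K_pos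
        have hp : ∀ i ∈ Finset.Icc 1 N, ∀ j, N ≤ j → 0 ≤ W i ω / totalWeight W j ω ∧
            W i ω / totalWeight W j ω ≤ 1 := fun i hi j hj => div_totalWeight_mem
          (Finset.Icc_subset_Icc_right hj hi) hω'.pos
        calc _ ≤ ∏ i ∈ Finset.Icc 1 N, Real.exp (-q * if 1 - ε ≤ W i ω then 1 else 0) := by
              -- Whatever the in-degrees at time N, antitonicity allows them to be replaced by 0.
              -- Vertices of weight below 1-ε contribute a factor at most 1; the others number at
              -- least N/K.
              refine Finset.prod_le_prod (fun i hi => evolve_nonneg (hp i hi) _ hf0 _)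
                fun i hi => (evolve_antitone (hp i hi) _ hanti (Nat.zero_le _)).trans ?_
              split_ifs with hW
              · refine (hE ω hω' i hi hW).trans ?_
                linarith [Real.add_one_le_exp (-q * 1)]
              · have := evolve_mono (m := m) (hp i hi) (n - N) hf1 0
                rw [evolve_one] at this
                simpa using this
          _ ≤ _ := by
              rw [← Real.exp_sum, Real.exp_le_exp, ← Finset.mul_sum, neg_mul, neg_le_neg_iff]
              refine mul_le_mul_of_nonneg_left ?_ hq
              rw [div_le_iff₀ hK0, mul_comm]
              exact hω'.le_count N hKN
    _ ≤ _ := by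
        rw [setLIntegral_const]
        exact mul_le_of_le_one_right' prob_le_one

lemma eventually_exp_neg_rpow_le {D χ : ℝ} (hD : 0 < D) (hχ : 0 < χ) :
    ∀ᶠ n : ℕ in atTop, Real.exp (-(D * (n : ℝ) ^ χ)) ≤ ((n : ℝ) ^ 2)⁻¹ := by
  have h := (isLittleO_log_rpow_atTop hχ).bound (half_pos hD)
  filter_upwards [tendsto_natCast_atTop_atTop.eventually h, eventually_ge_atTop 1] with n hn hn1
  have hn0 : (0 : ℝ) < n := by exact_mod_cast hn1
  rw [Real.norm_of_nonneg (Real.log_nonneg (by exact_mod_cast hn1)),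
    Real.norm_of_nonneg (by positivity)] at hn
  rw [← Real.le_log_iff_exp_le (by positivity), Real.log_inv, Real.log_pow]
  push_cast
  linarith

/-- Lower bound on the maximum in-degree, on the event of good weights. -/
lemma IsWRG.ae_exists_le_inDegree_aux [IsProbabilityMeasure μ] (h : IsWRG μ ν m W T)
    (hν : WeightLaw ν) (hm : 1 ≤ m) {c ε θ γ ρ y : ℝ} (hc : 0 < c) (hθ : θ = 1 + c / m)
    (hγ0 : 0 < γ) (hγ1 : γ < 1) (hρ : 0 < ρ) (hε : 0 < ε) (hε1 : ε ≤ 1)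
    (hερ : θ * (m * (ε * (1 + c⁻¹))) ≤ ρ / 8) (hy : y = θ * (1 - γ) / (θ - 1))
    (hg : (y + ρ) * Real.log θ - (θ - 1) / θ * (y - ρ / 4) < γ) (K : ℕ) :
    ∀ᵐ ω ∂μ, GoodWeights W c ε K ω → ∀ᶠ n : ℕ in atTop, ∃ i ∈ Finset.Icc 1 n,
      (y - ρ) * Real.log n ≤ inDegree T n i ω := by
  rcases Nat.eq_zero_or_pos K with rfl | hK
  · exact Eventually.of_forall fun ω hω => absurd hω.K_pos (lt_irrefl 0)
  have hK0 : (0 : ℝ) < K := by exact_mod_cast hK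
  obtain ⟨D, hD, htail⟩ := exists_evolve_tail_le (W := W) hm hc hθ hγ0.le hγ1 hρ hε hε1 hερ K hy
  set g := (y + ρ) * Real.log θ - (θ - 1) / θ * (y - ρ / 4) with hgdef
  have hfloor : Tendsto (fun n : ℕ => ⌊(n : ℝ) ^ γ⌋₊) atTop atTop :=
    tendsto_nat_floor_atTop.comp ((tendsto_rpow_atTop hγ0).comp tendsto_natCast_atTop_atTop)
  -- At least n^γ/(2K) heavy vertices, each with success probability at least D n^(-g): all fail
  -- with probability at most exp (-D n^(γ-g) / (2K)), which is summable as g < γ.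
  have hbound : ∀ᶠ n : ℕ in atTop, μ {ω | GoodWeights W c ε K ω ∧
      ∀ i ∈ Finset.Icc 1 ⌊(n : ℝ) ^ γ⌋₊, (inDegree T n i ω : ℝ) < (y - ρ) * Real.log n} ≤
      ENNReal.ofReal ((n : ℝ) ^ 2)⁻¹ := by
    filter_upwards [htail, eventually_ge_atTop 1, hfloor.eventually_ge_atTop K,
      eventually_exp_neg_rpow_le (by positivity : 0 < D / (2 * K)) (sub_pos.2 hg)]
      with n hn hn1 hnK hnexp
    have hn0 : (0 : ℝ) < n := by exact_mod_cast hn1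
    have hNn := floor_rpow_le hγ1.le hn1
    refine (h.measure_inDegree_lt_le hν (hK.trans_le hnK) hNn hnK (by positivity) hn).trans
      (ENNReal.ofReal_le_ofReal (le_trans (Real.exp_le_exp.2 (neg_le_neg ?_)) hnexp))
    calc D / (2 * K) * (n : ℝ) ^ (γ - g) = D * (n : ℝ) ^ (-g) * ((n : ℝ) ^ γ / 2 / K) := by
          rw [sub_eq_neg_add, Real.rpow_add hn0]; field_simp
      _ ≤ _ := by gcongr; exact half_rpow_le_floor hγ0.le hn1
  obtain ⟨n₁, hn₁⟩ := eventually_atTop.1 hbound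
  -- The clause n₁ ≤ n empties the events for which the bound is not available.
  have hBC : ∀ᵐ ω ∂μ, ∀ᶠ n : ℕ in atTop, ω ∉ {ω | n₁ ≤ n ∧ GoodWeights W c ε K ω ∧
      ∀ i ∈ Finset.Icc 1 ⌊(n : ℝ) ^ γ⌋₊, (inDegree T n i ω : ℝ) < (y - ρ) * Real.log n} := by
    refine ae_eventually_notMem (ne_top_of_le_ne_top ?_ (ENNReal.tsum_le_tsum
      (g := fun n : ℕ => ENNReal.ofReal ((n : ℝ) ^ 2)⁻¹) fun n => ?_))
    · rw [← ENNReal.ofReal_tsum_of_nonneg (fun n => by positivity)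
        (Real.summable_nat_pow_inv.2 one_lt_two)]
      exact ENNReal.ofReal_ne_top
    · by_cases hn : n₁ ≤ n
      · simpa [hn] using hn₁ n hn
      · simp [hn]
  filter_upwards [hBC] with ω hω hgood
  filter_upwards [hω, eventually_ge_atTop n₁, eventually_ge_atTop 1] with n hn hnn₁ hn1
  by_contra! hcon
  exact hn ⟨hnn₁, hgood, fun i hi =>
    hcon i (Finset.Icc_subset_Icc_right (floor_rpow_le hγ1.le hn1) hi)⟩

/-- At 1-γ = (θ-1)/(θ log θ) one has y = 1/log θ, and with ρ = 0 the cost equals γ exactly; a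
slightly larger γ makes the inequality strict. -/
lemma exists_exponents {θ δ : ℝ} (hθ1 : 1 < θ) (hθ2 : θ ≤ 2) (hδ : 0 < δ) :
    ∃ γ ρ y : ℝ, 0 < γ ∧ γ < 1 ∧ 0 < ρ ∧ y = θ * (1 - γ) / (θ - 1) ∧
      (y + ρ) * Real.log θ - (θ - 1) / θ * (y - ρ / 4) < γ ∧ 1 / Real.log θ - δ ≤ y - ρ := by
  have hlog : 0 < Real.log θ := Real.log_pos hθ1
  have hθ0 : 0 < θ := by linarith
  have hθ' : θ - 1 ≠ 0 := by linarith
  have hx : 0 < 1 / Real.log θ := by positivity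
  set x := 1 / Real.log θ with hxdef
  have hxl : x * Real.log θ = 1 := by rw [hxdef]; field_simp
  obtain ⟨e, he0, he1, heδ⟩ : ∃ e, 0 < e ∧ e ≤ 1 / 2 ∧ e * (x + 1) ≤ δ := by
    refine ⟨min (1 / 2) (δ / (x + 1)), by positivity, min_le_left _ _, ?_⟩
    rw [← le_div_iff₀ (by positivity)]; exact min_le_right _ _
  have hr0 : 0 < (θ - 1) / θ := div_pos (by linarith) hθ0
  have hr1 : (θ - 1) / θ ≤ 1 := by rw [div_le_one hθ0]; linarith
  have hrlog : (θ - 1) / θ * x < 1 := by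
    have h1 := Real.log_lt_sub_one_of_pos (x := θ⁻¹) (by positivity)
      (by rw [ne_eq, inv_eq_one]; exact hθ1.ne')
    rw [Real.log_inv] at h1
    have h2 : (θ - 1) / θ = 1 - θ⁻¹ := by field_simp
    have h3 : (θ - 1) / θ * x < Real.log θ * x := mul_lt_mul_of_pos_right (by linarith) hx
    linarith
  have hlog1 : Real.log θ ≤ 1 := by
    have := Real.log_le_sub_one_of_pos hθ0
    linarith
  have hrx : 0 < (θ - 1) / θ * x := by positivity
  -- Scaling 1-γ and y by 1-e opens a gap e between γ and the cost; ρ = e/4 uses at most e/4 + e/16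
  -- of it, since log θ ≤ 1.
  refine ⟨1 - (θ - 1) / θ * x * (1 - e), e / 4, x * (1 - e), ?_, ?_, by positivity, ?_, ?_, ?_⟩
  · nlinarith
  · have : 0 < (θ - 1) / θ * x * (1 - e) := mul_pos hrx (by linarith)
    linarith
  · field_simp; ring
  · have e1 : (x * (1 - e) + e / 4) * Real.log θ = (1 - e) + e / 4 * Real.log θ := by
      linear_combination (1 - e) * hxl
    rw [e1]
    have h1 : e / 4 * Real.log θ ≤ e / 4 * 1 := by gcongr
    have h2 : (θ - 1) / θ * (e / 4 / 4) ≤ 1 * (e / 4 / 4) := by gcongr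
    nlinarith
  · nlinarith

/-- Almost sure lower bound on the maximum in-degree. -/
lemma IsWRG.ae_exists_le_inDegree [IsProbabilityMeasure μ] (h : IsWRG μ ν m W T)
    (hν : WeightLaw ν) (hm : 1 ≤ m) {δ : ℝ} (hδ : 0 < δ) :
    ∀ᵐ ω ∂μ, ∀ᶠ n : ℕ in atTop, ∃ i ∈ Finset.Icc 1 n,
      (1 / Real.log (theta ν m) - δ) * Real.log n ≤ inDegree T n i ω := by
  have hm0 : (0 : ℝ) < m := by exact_mod_cast hm
  have hm1 : (1 : ℝ) ≤ m := by exact_mod_cast hm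
  have hc := hν.mean_pos
  have hc1 := hν.mean_le_one
  have hci := inv_pos.2 hc
  have hθ : theta ν m = 1 + (∫ x, x ∂ν) / m := rfl
  have hcm : 0 < (∫ x, x ∂ν) / m := by positivity
  have hcm1 : (∫ x, x ∂ν) / m ≤ 1 := by rw [div_le_one hm0]; linarith
  have hθ1 : 1 < theta ν m := by linarith
  obtain ⟨γ, ρ, y, hγ0, hγ1, hρ, hy, hg, hδy⟩ := exists_exponents hθ1 (by linarith) hδ
  obtain ⟨ε, hε, hε1, hερ⟩ : ∃ ε, 0 < ε ∧ ε ≤ 1 ∧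
      theta ν m * (m * (ε * (1 + (∫ x, x ∂ν)⁻¹))) ≤ ρ / 8 := by
    have hq : 0 < theta ν m * (m * (1 + (∫ x, x ∂ν)⁻¹)) := by positivity
    refine ⟨min 1 (ρ / 8 / (theta ν m * (m * (1 + (∫ x, x ∂ν)⁻¹)))), by positivity,
      min_le_left _ _, ?_⟩
    have := (le_div_iff₀ hq).1 (min_le_right 1 (ρ / 8 / (theta ν m * (m * (1 + (∫ x, x ∂ν)⁻¹)))))
    linarith
  filter_upwards [h.ae_exists_goodWeights hν hε, ae_all_iff.2 fun K =>
    h.ae_exists_le_inDegree_aux hν hm hc hθ hγ0 hγ1 hρ hε hε1 hερ hy hg K] with ω ⟨K, hK⟩ hω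
  filter_upwards [hω K hK] with n ⟨i, hi, hle⟩
  exact ⟨i, hi, (mul_le_mul_of_nonneg_right hδy (Real.log_natCast_nonneg n)).trans hle⟩

end WRG

namespace WRG
variable {Ω : Type*}

/-! ### The label of the maximum in-degree -/

/-- Nothing else about the label is needed: minimality among the maximizers plays no role in the
limit. -/
lemma maxDegreeLabel_mem {m : ℕ} (T : ℕ → Fin m → Ω → ℕ) {n : ℕ} (hn : 1 ≤ n) (ω : Ω) :
    maxDegreeLabel T n ω ∈ Finset.Icc 1 n ∧
      ∀ j ∈ Finset.Icc 1 n, inDegree T n j ω ≤ inDegree T n (maxDegreeLabel T n ω) ω := by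
  obtain ⟨i, hi, hmax⟩ := Finset.exists_max_image (Finset.Icc 1 n) (fun j => inDegree T n j ω)
    ⟨1, by simpa using hn⟩
  exact Nat.sInf_mem (s := {i | i ∈ Finset.Icc 1 n ∧
    ∀ j ∈ Finset.Icc 1 n, inDegree T n j ω ≤ inDegree T n i ω}) ⟨i, hi, hmax⟩

/-- The slope at `θ`, in the variable `u = (t - 1) / (θ - 1)`, that determines the exponent. -/
lemma tendsto_exponent {θ : ℝ} (hθ : 1 < θ) :
    Tendsto (fun t : ℝ => ((t - 1) / (θ - 1) - Real.log t / Real.log θ) / ((t - 1) / (θ - 1) - 1))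
      (𝓝[≠] θ) (𝓝 (1 - (θ - 1) / (θ * Real.log θ))) := by
  have hθ0 : 0 < θ := by linarith
  have hθ' : θ - 1 ≠ 0 := by linarith
  have hlog : Real.log θ ≠ 0 := (Real.log_pos hθ).ne'
  have hd := (Real.hasDerivAt_log hθ0.ne').tendsto_slope
  have h1 : Tendsto (fun t : ℝ => 1 - (θ - 1) / Real.log θ * slope Real.log θ t) (𝓝[≠] θ)
      (𝓝 (1 - (θ - 1) / Real.log θ * θ⁻¹)) := (hd.const_mul _).const_sub _
  have e : 1 - (θ - 1) / (θ * Real.log θ) = 1 - (θ - 1) / Real.log θ * θ⁻¹ := by field_simp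
  rw [e]
  refine h1.congr' ?_
  filter_upwards [self_mem_nhdsWithin] with t ht
  have ht' : t - θ ≠ 0 := sub_ne_zero.2 ht
  have h2 : (t - 1) / (θ - 1) - 1 = (t - θ) / (θ - 1) := by field_simp; ring
  rw [h2, slope_def_field]
  field_simp
  ring

variable [mΩ : MeasurableSpace Ω] {μ : Measure Ω} {ν : Measure ℝ} {m : ℕ}
  {W : ℕ → Ω → ℝ} {T : ℕ → Fin m → Ω → ℕ}

/-- The constraint on `log I_n / log n` obtained from the exponential moment at `t`. -/
lemma IsWRG.ae_eventually_label [IsProbabilityMeasure μ] (h : IsWRG μ ν m W T)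
    (hν : WeightLaw ν) (hm : 1 ≤ m) {t η : ℝ} (ht : 1 < t) (hη : 0 < η) :
    ∀ᵐ ω ∂μ, ∀ᶠ n : ℕ in atTop, Real.log t / Real.log (theta ν m) - (t - 1) / (theta ν m - 1) - η ≤
      (1 - (t - 1) / (theta ν m - 1)) * (Real.log (maxDegreeLabel T n ω) / Real.log n) := by
  have hm0 : (0 : ℝ) < m := by exact_mod_cast hm
  have hc := hν.mean_pos
  have hlt : 0 < Real.log t := Real.log_pos ht
  have ht0 : 0 < t - 1 := by linarith
  set u := (t - 1) / (theta ν m - 1) with hu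
  have hue : u = (t - 1) * (m * (∫ x, x ∂ν)⁻¹) := by
    rw [hu, theta, add_sub_cancel_left]; field_simp
  -- Error budget in units of log n: η/8 from ε, and η/4 each from δ, κ and the constant C, in total
  -- less than η.
  set ε := η / (8 * ((t - 1) * m)) with hε
  have hε0 : 0 < ε := by positivity
  have hεe : (t - 1) * (m * ε) = η / 8 := by rw [hε]; field_simp
  set δ := η / (4 * Real.log t) with hδ
  have hδ0 : 0 < δ := by positivity
  have hδe : δ * Real.log t = η / 4 := by rw [hδ]; field_simp
  filter_upwards [h.ae_exists_le_inDegree hν hm hδ0,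
    h.ae_inDegree_le hν hε0 (by positivity : 0 < η / 4) ht rfl] with ω hlow ⟨C, hup⟩
  have hlog : Tendsto (fun n : ℕ => Real.log n) atTop atTop :=
    Real.tendsto_log_atTop.comp tendsto_natCast_atTop_atTop
  filter_upwards [hlow, eventually_ge_atTop 1, hlog.eventually_ge_atTop 1,
    hlog.eventually_ge_atTop (C / (η / 4))] with n ⟨i, hi, hle⟩ hn1 hL1 hLC
  obtain ⟨hI, hmax⟩ := maxDegreeLabel_mem T hn1 ω
  have h1 := hup n _ hI
  have h2 : (inDegree T n i ω : ℝ) ≤ inDegree T n (maxDegreeLabel T n ω) ω := by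
    exact_mod_cast hmax i hi
  have h3 := mul_le_mul_of_nonneg_right (hle.trans h2) hlt.le
  have hI1 : (1 : ℝ) ≤ maxDegreeLabel T n ω := by exact_mod_cast (Finset.mem_Icc.1 hI).1
  have hlI : 0 ≤ Real.log (maxDegreeLabel T n ω) := Real.log_nonneg hI1
  set L := Real.log n with hL
  set ℓ := Real.log (maxDegreeLabel T n ω) with hℓ
  have hC : C ≤ η / 4 * L := by
    rwa [div_le_iff₀ (by positivity), mul_comm] at hLC
  have hα : (t - 1) * (m * ((∫ x, x ∂ν)⁻¹ + ε)) = u + η / 8 := by rw [hue, ← hεe]; ring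
  rw [hα] at h1
  have hL0 : 0 < L := by linarith
  have hηℓ : 0 ≤ η / 8 * ℓ := by positivity
  have h4 : (1 / Real.log (theta ν m) - δ) * L * Real.log t =
      (Real.log t / Real.log (theta ν m)) * L - η / 4 * L := by
    rw [← hδe]; ring
  rw [h4] at h3
  rw [← mul_div_assoc, le_div_iff₀ hL0]
  have hηL : 0 < η * L := by positivity
  linarith

end WRG

/-! ### Convergence of the exponent, by tilts on both sides of θ -/

theorem mainTheorem1 {Ω : Type*} [MeasurableSpace Ω] (μ : Measure Ω) [IsProbabilityMeasure μ]
    (ν : Measure ℝ) (m : ℕ) (hm : 1 ≤ m)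
    (hpos : ∀ᵐ x ∂ν, 0 < x)
    (hsup : IsLUB {x : ℝ | 0 < x ∧ ν (Set.Iic x) < 1} 1)
    (W : ℕ → Ω → ℝ) (T : ℕ → Fin m → Ω → ℕ) (hWRG : WRG.IsWRG μ ν m W T) :
    ∀ᵐ ω ∂μ, Tendsto (fun n : ℕ => Real.log (WRG.maxDegreeLabel T n ω) / Real.log n) atTop
      (𝓝 (WRG.muExponent ν m)) := by
  have hν := hWRG.weightLaw hpos hsup
  have hm0 : (0 : ℝ) < m := by exact_mod_cast hm
  have hθ1 : 1 < WRG.theta ν m := by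
    have := div_pos hν.mean_pos hm0
    unfold WRG.theta; linarith
  set θ := WRG.theta ν m with hθ
  have hslope := WRG.tendsto_exponent hθ1
  have key : ∀ k : ℕ, ∀ᵐ ω ∂μ, ∀ᶠ n : ℕ in atTop,
      |Real.log (WRG.maxDegreeLabel T n ω) / Real.log n - WRG.muExponent ν m| <
        1 / ((k : ℝ) + 1) := by
    intro k
    have hk : 0 < 1 / ((k : ℝ) + 1) := Nat.one_div_pos_of_nat
    set β := 1 / ((k : ℝ) + 1) with hβ
    have hball := Metric.tendsto_nhds.1 hslope (β / 2) (by positivity)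
    have hleft : ∀ᶠ t in 𝓝[<] θ, dist (((t - 1) / (θ - 1) - Real.log t / Real.log θ) /
        ((t - 1) / (θ - 1) - 1)) (WRG.muExponent ν m) < β / 2 :=
      hball.filter_mono (nhdsWithin_mono _ fun t ht => ne_of_lt ht)
    have hright : ∀ᶠ t in 𝓝[>] θ, dist (((t - 1) / (θ - 1) - Real.log t / Real.log θ) /
        ((t - 1) / (θ - 1) - 1)) (WRG.muExponent ν m) < β / 2 :=
      hball.filter_mono (nhdsWithin_mono _ fun t ht => ne_of_gt ht)
    -- The parameter t₁ < θ yields the lower bound on log I_n / log n and t₂ > θ the upper one, as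
    -- 1-u changes sign at θ.
    obtain ⟨t₁, hd₁, ht₁, ht₁θ⟩ := (hleft.and (Ioo_mem_nhdsLT hθ1)).exists
    obtain ⟨t₂, hd₂, ht₂⟩ := (hright.and self_mem_nhdsWithin).exists
    have hθ0 : 0 < θ - 1 := by linarith
    have ht₂θ : θ < t₂ := ht₂
    have hu₁ : (t₁ - 1) / (θ - 1) < 1 := by rw [div_lt_one hθ0]; linarith
    have hu₂ : 1 < (t₂ - 1) / (θ - 1) := by rw [one_lt_div hθ0]; linarith
    rw [Real.dist_eq, abs_lt] at hd₁ hd₂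
    -- Scaled by |1-u|, so that division by 1-u costs β/2; the other β/2 is the distance of the
    -- quotient from its limit.
    have hη₁ : 0 < (1 - (t₁ - 1) / (θ - 1)) * (β / 2) := mul_pos (by linarith) (by positivity)
    have hη₂ : 0 < ((t₂ - 1) / (θ - 1) - 1) * (β / 2) := mul_pos (by linarith) (by positivity)
    filter_upwards [hWRG.ae_eventually_label hν hm ht₁ hη₁,
      hWRG.ae_eventually_label hν hm (hθ1.trans ht₂θ) hη₂] with ω h₁ h₂
    filter_upwards [h₁, h₂] with n hn₁ hn₂
    rw [← hθ] at hn₁ hn₂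
    generalize Real.log (WRG.maxDegreeLabel T n ω) / Real.log n = x at hn₁ hn₂ ⊢
    generalize WRG.muExponent ν m = e at hd₁ hd₂ ⊢
    generalize (t₁ - 1) / (θ - 1) = u₁ at *
    generalize (t₂ - 1) / (θ - 1) = u₂ at *
    generalize Real.log t₁ / Real.log θ = l₁ at *
    generalize Real.log t₂ / Real.log θ = l₂ at *
    rw [abs_lt]
    constructor
    · have h3 : e - β / 2 < (u₁ - l₁) / (u₁ - 1) := by linarith [hd₁.1]
      rw [lt_div_iff_of_neg (by linarith)] at h3
      by_contra! hcon
      nlinarith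
    · have h3 : (u₂ - l₂) / (u₂ - 1) < e + β / 2 := by linarith [hd₂.2]
      rw [div_lt_iff₀ (by linarith)] at h3
      by_contra! hcon
      nlinarith
  filter_upwards [ae_all_iff.2 key] with ω hω
  refine Metric.tendsto_nhds.2 fun r hr => ?_
  obtain ⟨k, hk⟩ := exists_nat_one_div_lt hr
  filter_upwards [hω k] with n hn
  rw [Real.dist_eq]
  exact hn.trans hk
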